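/- For integers $l_1\ge 2$, $l_2,\dots,l_n\ge 1$ let $\zeta(l_1,\dots,l_n)=\sum_{m_1>\cdots>m_n>0} m_1^{-l_1}\cdots m_n^{-l_n}$ be the multiple zeta value, so that $\zeta(l)$ is the Riemann zeta value. For $l>n\ge1$ and complex numbers $x,y$ put $$S_{l,n}(x,y)=\sum_{\substack{l_1\ge2,\ l_2,\dots,l_n\ge1\\ l_1+\cdots+l_n=l}} x^{l_1-1}\,y^{\,l-l_1-(n-1)}\,\zeta(l_1,\dots,l_n).$$ Let $\delta_{i,j}$ be Kronecker's delta; empty sums are $0$, and $0^0=1$. Then for all complex numbers $x,y$ and all integers $l$: (i) If $l\ge3$, then $$S_{l,2}(x+y,y)+S_{l,2}(y+x,x)=\frac{l+1}{2}\left(x^{l-2}+y^{l-2}\right)\zeta(l)-\frac12\sum_{\substack{j_1,j_2\ge2\\ j_1+j_2=l}}\ \prod_{i=1}^{2}\left(x^{j_i-1}-y^{j_i-1}\right)\zeta(j_i).$$ (ii) If $l\ge4$, then $$\begin{aligned}S_{l,3}(x+y,y)-S_{l,3}(y+x,x)={}&\frac{(l+1)(l-4)}{6}\left(x^{l-3}-y^{l-3}\right)\zeta(l)\\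 &-\frac12\sum_{\substack{j_1\ge2,\ j_2\ge3\\ j_1+j_2=l}}(j_2-1)\prod_{i=1}^{2}\left(x^{j_i-1-\delta_{i,2}}-(-1)^{\delta_{i,2}}y^{j_i-1-\delta_{i,2}}\right)\zeta(j_i)\\ &+\frac16\sum_{\substack{j_1,j_2,j_3\ge2\\ j_1+j_2+j_3=l}}\ \prod_{i=1}^{3}\left(x^{j_i-1}-y^{j_i-1}\right)\zeta(j_i).\end{aligned}$$ (iii) If $l\ge5$, then $$\begin{aligned}S_{l,4}(x+y,y)+S_{l,4}(y+x,x)={}&\frac{(l+1)(l^2-7l+18)}{24}\left(x^{l-4}+y^{l-4}\right)\zeta(l)\\ &-\frac16\sum_{\substack{j_1\ge2,\ j_2\ge4\\ j_1+j_2=l}}(j_2-1)(j_2-2)\prod_{i=1}^{2}\left(x^{j_i-1-2\delta_{i,2}}-y^{j_i-1-2\delta_{i,2}}\right)\zeta(j_i)\\ &-\frac18\sum_{\substack{j_1,j_2\ge3\\ j_1+j_2=l}}\ \prod_{i=1}^{2}(j_i-1)\left(x^{j_i-2}+y^{j_i-2}\right)\zeta(j_i)\\ &+\frac14\sum_{\substack{j_1,j_2\ge2,\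 j_3\ge3\\ j_1+j_2+j_3=l}}(j_3-1)\prod_{i=1}^{3}\left(x^{j_i-1-\delta_{i,3}}-(-1)^{\delta_{i,3}}y^{j_i-1-\delta_{i,3}}\right)\zeta(j_i)\\ &-\frac1{24}\sum_{\substack{j_1,j_2,j_3,j_4\ge2\\ j_1+j_2+j_3+j_4=l}}\ \prod_{i=1}^{4}\left(x^{j_i-1}-y^{j_i-1}\right)\zeta(j_i).\end{aligned}$$ In particular, (i) with $x=y=1$ gives the weighted Euler sum formula of Ohno and Zudilin: for every integer $l\ge3$, $$\sum_{j=2}^{l-1}2^{j}\,\zeta(j,l-j)=(l+1)\,\zeta(l).$$ -/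

import Mathlib

/-- The multiple zeta value `ζ(k₁, …, kₙ) = ∑_{m₁ > ⋯ > mₙ > 0} 1 / (m₁ ^ k₁ ⋯ mₙ ^ kₙ)`;
the argument is meant to be a tuple of positive integers with first entry at least `2`
(the series then converges, see `summable_mzv`). -/
noncomputable def mzv {n : ℕ} (k : Fin n → ℕ) : ℝ :=
  ∑' m : {m : Fin n → ℕ // StrictAnti m ∧ ∀ i, 0 < m i}, ∏ i, 1 / (m.1 i : ℝ) ^ k i

/-- The `n`-tuples `(j₁, …, jₙ)` of natural numbers with `j₁ + ⋯ + jₙ = l` and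
`jᵢ ≥ bᵢ` for every `i`. -/
def tuples {n : ℕ} (l : ℕ) (b : Fin n → ℕ) : Finset (Fin n → ℕ) :=
  (Finset.Nat.antidiagonalTuple n l).filter fun j => ∀ i, b i ≤ j i

theorem mem_tuples {n l : ℕ} {b j : Fin n → ℕ} :
    j ∈ tuples l b ↔ ∑ i, j i = l ∧ ∀ i, b i ≤ j i := by
  simp [tuples, Finset.Nat.mem_antidiagonalTuple]

/-- The weighted sum with two parameters
`S_{l,n}(x,y) = ∑ x ^ (l₁ - 1) * y ^ (l - l₁ - (n - 1)) * ζ(l₁, …, lₙ)`, the sum being over the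
`n`-tuples with `l₁ ≥ 2`, `l₂, …, lₙ ≥ 1` and `l₁ + ⋯ + lₙ = l`. On this range the exponents
are truly nonnegative. -/
noncomputable def weightedSum (l n : ℕ) [NeZero n] (x y : ℂ) : ℂ :=
  ∑ k ∈ tuples l (fun i : Fin n => if i = 0 then 2 else 1),
    x ^ (k 0 - 1) * y ^ (l - k 0 - (n - 1)) * (mzv k : ℂ)

/-- Kronecker's delta. -/
def kron {n : ℕ} (i j : Fin n) : ℕ := if i = j then 1 else 0

/-- A product of a summable nonnegative function over the coordinates is summable. -/
theorem summable_pi_prod {f : ℕ → ℝ} (hf : Summable f) (h0 : ∀ a, 0 ≤ f a) (n : ℕ) :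
    Summable fun m : Fin n → ℕ => ∏ i, f (m i) := by
  induction n with
  | zero => exact Summable.of_finite
  | succ n ih =>
    have h := Summable.mul_of_nonneg hf ih h0
      (fun m => Finset.prod_nonneg fun i _ => h0 (m i))
    rw [← (Fin.consEquiv fun _ : Fin (n + 1) => ℕ).summable_iff]
    refine h.congr fun p => ?_
    simp [Fin.consEquiv, Fin.prod_univ_succ]

/-- The series defining a multiple zeta value converges on the intended tuples. -/
theorem summable_mzv {n : ℕ} [NeZero n] (k : Fin n → ℕ) (h0 : 2 ≤ k 0) (h : ∀ i, 1 ≤ k i) :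
    Summable fun m : {m : Fin n → ℕ // StrictAnti m ∧ ∀ i, 0 < m i} =>
      ∏ i, 1 / (m.1 i : ℝ) ^ k i := by
  have hn : (0 : ℝ) < n := by exact_mod_cast Nat.pos_of_ne_zero (NeZero.ne n)
  have hs : Summable fun a : ℕ => ((a : ℝ) ^ (1 + 1 / (n : ℝ)))⁻¹ :=
    Real.summable_nat_rpow_inv.mpr (by have : 0 < 1 / (n : ℝ) := by positivity
                                       linarith)
  have hs' := (summable_pi_prod hs (fun a => by positivity) n).comp_injective
    (Subtype.val_injective (p := fun m : Fin n → ℕ => StrictAnti m ∧ ∀ i, 0 < m i))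
  refine Summable.of_nonneg_of_le (fun m => Finset.prod_nonneg fun i _ => by positivity)
    (fun m => ?_) hs'
  obtain ⟨m, hm, hp⟩ := m
  have hp' : ∀ i, (1 : ℝ) ≤ m i := fun i => by exact_mod_cast hp i
  have hpos : ∀ i, (0 : ℝ) < m i := fun i => lt_of_lt_of_le one_pos (hp' i)
  simp only [Function.comp_apply, one_div, Finset.prod_inv_distrib]
  refine inv_anti₀ (Finset.prod_pos fun i _ => Real.rpow_pos_of_pos (hpos i) _) ?_
  have e1 : ∏ i, (m i : ℝ) ^ (1 + (n : ℝ)⁻¹) ≤ (m 0 : ℝ) * ∏ i, (m i : ℝ) := by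
    simp_rw [fun i => Real.rpow_add (hpos i), Real.rpow_one, Finset.prod_mul_distrib]
    rw [mul_comm]
    refine mul_le_mul_of_nonneg_right ?_ (Finset.prod_nonneg fun i _ => (hpos i).le)
    calc ∏ i, (m i : ℝ) ^ (n : ℝ)⁻¹ ≤ ∏ _i : Fin n, (m 0 : ℝ) ^ (n : ℝ)⁻¹ := by
          refine Finset.prod_le_prod (fun i _ => (Real.rpow_pos_of_pos (hpos i) _).le)
            fun i _ => Real.rpow_le_rpow (hpos i).le ?_ (by positivity)
          exact_mod_cast hm.antitone (Fin.zero_le i)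
      _ = (m 0 : ℝ) := by
          rw [Finset.prod_const, Finset.card_univ, Fintype.card_fin]
          exact Real.rpow_inv_natCast_pow (hpos 0).le (NeZero.ne n)
  refine e1.trans ?_
  rw [← Finset.mul_prod_erase _ _ (Finset.mem_univ (0 : Fin n)),
    ← Finset.mul_prod_erase _ (fun i => (m i : ℝ) ^ k i) (Finset.mem_univ (0 : Fin n)),
    ← mul_assoc]
  refine mul_le_mul ?_ ?_ (Finset.prod_nonneg fun i _ => (hpos i).le)
    (pow_nonneg (hpos 0).le _)
  · rw [← sq]
    exact pow_le_pow_right₀ (hp' 0) h0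
  · exact Finset.prod_le_prod (fun i _ => (hpos i).le) fun i _ =>
      le_self_pow₀ (hp' i) (Nat.one_le_iff_ne_zero.mp (h i))

open Finset.HasAntidiagonal (antidiagonal)

/-! ### Coefficientwise seminorms on `ℂ⟦t⟧⟦z⟧` -/

/-! Work in `Ser`, that is ℂ⟦t⟧⟦z⟧. Put Q_{y,s}(n) = ∏_{1≤j≤n} (1 + sz/(j − yt)) (`QQ`) and G(w,y,s)
= ∑_{m≥0} (1/(m+1−wt) − 1/(m+1)) Q_{y,s}(m) (`genSum`). The coefficient of z^i t^D in G is s^i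
S_{D+i+1,i+1}(w,y) (`co_genSum`); subtracting 1/(m+1) discards the divergent terms l₁ = 1. The three
formulas are the coefficients of z², z³, z⁴ in the single identity z(G(x+y,y,1) − G(x+y,x,−1)) =
zG(y,y,1) − zG(x,x,−1) − (β − 1) of `zz_mul_genSum_sub`.

The identity is hypergeometric. The series ∑ Q_{y,s}(n) S^n is ₂F₁(1, 1−yt+sz; 1−yt; S), and Euler's
transformation (`mk_QQ_eq`) factors it as (1−S)^{−1−sz} B_{y,s}(S) with B_{y,s} = ₂F₁(−sz, −yt;
1−yt; S). In B_{y,s} B_{x,−s} the powers of 1−S combine to (1−S)², so this product is a convolution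
of Q_{y,s} with Q_{x,−s}, which partial fractions evaluate (`zz_mul_sum_antidiagonal`). Setting S =
1 gives the identity, with β = B_{y,1}(1) B_{x,−1}(1).

Two evaluations remain. The classical sum formula G(y,y,s) = ∑_k yt/((k+1−yt)(k+1−sz)) follows from
a telescoping connected sum (`conv_genSum_self`). For β, a substitute for Gauss's theorem presents
it as a ratio of limits of products (`conv_QQ_mul_QQ`); its logarithmic derivative in z is then a
series in single zeta values (`dz_beta`), and Newton's recursion yields its coefficients.

Convergence is coefficientwise throughout. The truncated ℓ¹ seminorms `nrm` are submultiplicative,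
and every sequence is bounded by a power of log n times a power of 1/n. -/

theorem sum_range_sum_antidiagonal {M : Type*} [AddCommMonoid M] (f : ℕ → ℕ → M) (I : ℕ) :
    ∑ i ∈ Finset.range I, ∑ p ∈ antidiagonal i, f p.1 p.2 =
      ∑ i ∈ Finset.range I, ∑ j ∈ Finset.range (I - i), f i j := by
  rw [← Finset.sum_range_diag_flip]
  exact Finset.sum_congr rfl fun i _ =>
    Finset.Nat.sum_antidiagonal_eq_sum_range_succ f i

theorem sum_range_antidiagonal_le {a b : ℕ → ℝ} (ha : ∀ i, 0 ≤ a i) (hb : ∀ i, 0 ≤ b i) (I : ℕ) :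
    ∑ i ∈ Finset.range I, ∑ p ∈ antidiagonal i, a p.1 * b p.2 ≤
      (∑ i ∈ Finset.range I, a i) * ∑ i ∈ Finset.range I, b i := by
  rw [sum_range_sum_antidiagonal (fun i j => a i * b j), Finset.sum_mul_sum]
  refine Finset.sum_le_sum fun i _ => Finset.sum_le_sum_of_subset_of_nonneg
    (Finset.range_mono (Nat.sub_le _ _)) fun j _ _ => mul_nonneg (ha i) (hb j)

theorem RingSeminorm.map_sum_le {R ι : Type*} [CommRing R] (p : RingSeminorm R) (s : Finset ι)
    (f : ι → R) : p (∑ i ∈ s, f i) ≤ ∑ i ∈ s, p (f i) :=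
  Finset.le_sum_of_subadditive p (map_zero p).le (map_add_le_add p) _ _

/-- The seminorm on `R⟦X⟧` adding up the seminorms of the first `I` coefficients. -/
noncomputable def RingSeminorm.powerSeries {R : Type*} [CommRing R] (p : RingSeminorm R) (I : ℕ) :
    RingSeminorm (PowerSeries R) where
  toFun f := ∑ i ∈ Finset.range I, p (PowerSeries.coeff i f)
  map_zero' := by simp
  add_le' f g := by
    rw [← Finset.sum_add_distrib]
    exact Finset.sum_le_sum fun i _ => by simpa using map_add_le_add p _ _
  neg' f := by simp
  mul_le' f g := by
    refine le_trans (Finset.sum_le_sum fun i _ => ?_) (sum_range_antidiagonal_le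
      (fun i => apply_nonneg p (PowerSeries.coeff i f))
      (fun i => apply_nonneg p (PowerSeries.coeff i g)) I)
    rw [PowerSeries.coeff_mul]
    exact (p.map_sum_le _ _).trans (Finset.sum_le_sum fun q _ => map_mul_le_mul p _ _)

theorem RingSeminorm.powerSeries_apply {R : Type*} [CommRing R] (p : RingSeminorm R) (I : ℕ)
    (f : PowerSeries R) :
    p.powerSeries I f = ∑ i ∈ Finset.range I, p (PowerSeries.coeff i f) := rfl

theorem RingSeminorm.powerSeries_one_le {R : Type*} [CommRing R] (p : RingSeminorm R)
    (hp : p 1 ≤ 1) (I : ℕ) : p.powerSeries I 1 ≤ 1 := by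
  rw [RingSeminorm.powerSeries_apply]
  cases I with
  | zero => simp
  | succ I => simpa [Finset.sum_range_succ', PowerSeries.coeff_one] using hp

theorem RingSeminorm.powerSeries_C_mul_X_mul_le {R : Type*} [CommRing R] (p : RingSeminorm R)
    (I : ℕ) (c : R) (f : PowerSeries R) :
    p.powerSeries (I + 1) (PowerSeries.C c * PowerSeries.X * f) ≤ p c * p.powerSeries I f := by
  simp only [RingSeminorm.powerSeries_apply]
  rw [Finset.sum_range_succ', Finset.mul_sum]
  simp only [mul_assoc, PowerSeries.coeff_C_mul, PowerSeries.coeff_succ_X_mul,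
    PowerSeries.coeff_zero_X_mul, mul_zero, map_zero, add_zero]
  exact Finset.sum_le_sum fun i _ => map_mul_le_mul p _ _

/-- The ring `ℂ⟦t⟧⟦z⟧`. -/
abbrev Ser := PowerSeries (PowerSeries ℂ)

/-- The coefficient of `z ^ i * t ^ d`. -/
noncomputable def co (i d : ℕ) : Ser →+ ℂ :=
  ((PowerSeries.coeff d : PowerSeries ℂ →ₗ[ℂ] ℂ).toAddMonoidHom).comp
    (PowerSeries.coeff i : Ser →ₗ[PowerSeries ℂ] PowerSeries ℂ).toAddMonoidHom

theorem co_apply (i d : ℕ) (f : Ser) :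
    co i d f = PowerSeries.coeff d (PowerSeries.coeff i f) := rfl

theorem Ser.ext {f g : Ser} (h : ∀ i d, co i d f = co i d g) : f = g :=
  PowerSeries.ext fun i => PowerSeries.ext fun d => h i d

theorem co_mul (i d : ℕ) (f g : Ser) :
    co i d (f * g) = ∑ p ∈ antidiagonal i, ∑ q ∈ antidiagonal d,
      co p.1 q.1 f * co p.2 q.2 g := by
  simp [co_apply, PowerSeries.coeff_mul]

/-- The sum of the absolute values of the coefficients of `z ^ i * t ^ d`, `i < I`, `d < D`. -/
noncomputable def nrm (I D : ℕ) : RingSeminorm Ser :=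
  ((normRingSeminorm ℂ).powerSeries D).powerSeries I

theorem nrm_apply (I D : ℕ) (f : Ser) :
    nrm I D f = ∑ i ∈ Finset.range I, ∑ d ∈ Finset.range D, ‖co i d f‖ := rfl

theorem nrm_one_le (I D : ℕ) : nrm I D 1 ≤ 1 :=
  RingSeminorm.powerSeries_one_le _ (RingSeminorm.powerSeries_one_le _ (norm_one (α := ℂ)).le _) _

theorem norm_co_le (i d : ℕ) (f : Ser) : ‖co i d f‖ ≤ nrm (i + 1) (d + 1) f := by
  rw [nrm_apply]
  refine le_trans ?_ (Finset.single_le_sum (f := fun i => ∑ d' ∈ Finset.range (d + 1), ‖co i d' f‖)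
    (fun i _ => Finset.sum_nonneg fun d _ => norm_nonneg _) (Finset.self_mem_range_succ i))
  exact Finset.single_le_sum (f := fun d' => ‖co i d' f‖) (fun d _ => norm_nonneg _)
    (Finset.self_mem_range_succ d)

/-- The element `s * z`. -/
noncomputable def zz (s : ℂ) : Ser := PowerSeries.C (PowerSeries.C s) * PowerSeries.X

/-- The element `y * t`. -/
noncomputable def tt (y : ℂ) : Ser := PowerSeries.C (PowerSeries.C y * PowerSeries.X)

theorem RingSeminorm.powerSeries_C_le {R : Type*} [CommRing R] (p : RingSeminorm R) (I : ℕ)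
    (c : R) : p.powerSeries I (PowerSeries.C c) ≤ p c := by
  rw [RingSeminorm.powerSeries_apply]
  cases I with
  | zero => simp
  | succ I => simp [Finset.sum_range_succ', PowerSeries.coeff_C]

theorem nrm_zz_mul_le (K D : ℕ) (s : ℂ) (f : Ser) :
    nrm (K + 1) D (zz s * f) ≤ ‖s‖ * nrm K D f :=
  (RingSeminorm.powerSeries_C_mul_X_mul_le _ _ _ _).trans <| mul_le_mul_of_nonneg_right
    (RingSeminorm.powerSeries_C_le _ _ _) (apply_nonneg _ _)

theorem nrm_tt_mul_le (I K : ℕ) (y : ℂ) (f : Ser) :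
    nrm I (K + 1) (tt y * f) ≤ ‖y‖ * nrm I K f := by
  simp only [nrm, tt]
  rw [RingSeminorm.powerSeries_apply, RingSeminorm.powerSeries_apply, Finset.mul_sum]
  refine Finset.sum_le_sum fun i _ => ?_
  rw [PowerSeries.coeff_C_mul]
  exact RingSeminorm.powerSeries_C_mul_X_mul_le (normRingSeminorm ℂ) K y _

theorem nrm_zero_left (D : ℕ) (f : Ser) : nrm 0 D f = 0 := by simp [nrm_apply]

theorem nrm_zero_right (I : ℕ) (f : Ser) : nrm I 0 f = 0 := by simp [nrm_apply]

/-! ### Logarithmic bounds -/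

/-- One plus the `n`-th harmonic number. -/
noncomputable def har (n : ℕ) : ℝ := 1 + ∑ j ∈ Finset.range n, 1 / ((j : ℝ) + 1)

theorem har_succ (n : ℕ) : har (n + 1) = har n + 1 / ((n : ℝ) + 1) := by
  rw [har, har, Finset.sum_range_succ, add_assoc]

theorem har_mono : Monotone har := monotone_nat_of_le_succ fun n => by
  rw [har_succ]
  have : 0 < 1 / ((n : ℝ) + 1) := by positivity
  linarith

theorem one_le_har (n : ℕ) : 1 ≤ har n := by simpa [har] using har_mono (Nat.zero_le n)

theorem har_pos (n : ℕ) : 0 < har n := one_pos.trans_le (one_le_har n)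

theorem har_succ_le (n : ℕ) : har (n + 1) ≤ 2 * har n := by
  rw [har_succ]
  have : 1 / ((n : ℝ) + 1) ≤ 1 := by
    rw [div_le_one (by positivity)]; linarith [n.cast_nonneg (α := ℝ)]
  linarith [one_le_har n]

theorem sum_har_le (n : ℕ) : ∑ j ∈ Finset.range n, 1 / ((j : ℝ) + 1) ≤ har n := by
  rw [har]; linarith

/-- Multiplication by `e` lowers the truncation order by one, so only `K` orders of the expanded
product survive, and each costs one harmonic sum. It is applied to `e = zz s` (truncation in z) for
`QQ` and to `e = tt y` (truncation in t) for `conn`. -/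
theorem RingSeminorm.prod_one_add_le {R : Type*} [CommRing R] (p : ℕ → RingSeminorm R) {e : R}
    {c c' : ℝ} (hp1 : ∀ K, p K 1 ≤ 1) (hp0 : ∀ f, p 0 f = 0) (hc : 0 ≤ c) (hc' : 0 ≤ c')
    (he : ∀ K f, p (K + 1) (e * f) ≤ c * p K f) {h : ℕ → R} (K : ℕ)
    (hh : ∀ k ≤ K, ∀ j : ℕ, p k (h j) ≤ c' / ((j : ℝ) + 1)) (n : ℕ) :
    p K (∏ j ∈ Finset.range n, (1 + e * h j)) ≤ ((1 + c * c') * har n) ^ K := by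
  -- Sorting the expansion by the largest index chosen exposes one factor `e`, which drives the
  -- induction on `K`.
  have key : ∀ n, ∏ j ∈ Finset.range n, (1 + e * h j) =
      1 + e * ∑ j ∈ Finset.range n, h j * ∏ i ∈ Finset.range j, (1 + e * h i) := by
    intro n
    induction n with
    | zero => simp
    | succ n ih => rw [Finset.prod_range_succ, Finset.sum_range_succ]; linear_combination ih
  induction K generalizing n with
  | zero => simp [hp0]
  | succ K ih =>
    have hcc : 0 ≤ c * c' := mul_nonneg hc hc'
    have hL := one_le_har n
    have hB : (1 : ℝ) ≤ (1 + c * c') * har n := by nlinarith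
    set B := ((1 + c * c') * har n) ^ K with hBdef
    have hB1 : 1 ≤ B := one_le_pow₀ hB
    rw [key]
    have h1 : p K (∑ j ∈ Finset.range n, h j * ∏ i ∈ Finset.range j, (1 + e * h i)) ≤
        c' * B * har n := by
      calc _ ≤ ∑ j ∈ Finset.range n, c' * B * (1 / ((j : ℝ) + 1)) := by
            refine ((p K).map_sum_le _ _).trans (Finset.sum_le_sum fun j hj => ?_)
            refine (map_mul_le_mul (p K) _ _).trans ?_
            have h2 := hh K (Nat.le_succ K) j
            have h3 := ih (fun k hk => hh k (hk.trans (Nat.le_succ K))) j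
            have h4 : ((1 + c * c') * har j) ^ K ≤ B := by
              refine pow_le_pow_left₀ (by have := har_pos j; positivity) ?_ K
              exact mul_le_mul_of_nonneg_left (har_mono (Finset.mem_range.mp hj).le) (by positivity)
            calc _ ≤ c' / ((j : ℝ) + 1) * B :=
                  mul_le_mul h2 (h3.trans h4) (apply_nonneg _ _) (by positivity)
              _ = _ := by ring
        _ = c' * B * ∑ j ∈ Finset.range n, 1 / ((j : ℝ) + 1) := by rw [Finset.mul_sum]
        _ ≤ _ := mul_le_mul_of_nonneg_left (sum_har_le n) (by positivity)
    calc _ ≤ 1 + c * (c' * B * har n) :=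
          (map_add_le_add (p (K + 1)) _ _).trans (add_le_add (hp1 _)
            ((he K _).trans (mul_le_mul_of_nonneg_left h1 hc)))
      _ ≤ B * har n + c * (c' * B * har n) := by nlinarith
      _ = ((1 + c * c') * har n) ^ (K + 1) := by rw [pow_succ, ← hBdef]; ring

theorem har_le_log (n : ℕ) : har n ≤ 2 + Real.log ((n : ℝ) + 1) := by
  have h1 : har n = 1 + (harmonic n : ℝ) := by simp [har, harmonic]
  have h2 := harmonic_le_one_add_log n
  have h3 : Real.log n ≤ Real.log ((n : ℝ) + 1) := by
    rcases Nat.eq_zero_or_pos n with rfl | h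
    · simp
    · exact Real.log_le_log (by exact_mod_cast h) (by linarith)
  linarith

/-- Any exponent strictly between 0 and 1 would serve: it still lets division by n+1 give a null
sequence and division by (n+1)² a summable one. -/
theorem exists_har_pow_le (k : ℕ) : ∃ C : ℝ, ∀ n : ℕ, har n ^ k ≤ C * ((n : ℝ) + 1) ^ (1 / 2 : ℝ) := by
  set ε : ℝ := 1 / (2 * (k + 1)) with hε
  have hε0 : 0 < ε := by positivity
  refine ⟨(2 + 1 / ε) ^ k, fun n => ?_⟩
  have hn : (1 : ℝ) ≤ (n : ℝ) + 1 := by linarith [n.cast_nonneg (α := ℝ)]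
  have h1 : har n ≤ (2 + 1 / ε) * ((n : ℝ) + 1) ^ ε := by
    have h2 := Real.log_le_rpow_div (x := (n : ℝ) + 1) (by linarith) hε0
    have h3 : 1 ≤ ((n : ℝ) + 1) ^ ε := Real.one_le_rpow hn hε0.le
    calc har n ≤ 2 * 1 + ((n : ℝ) + 1) ^ ε / ε := by linarith [har_le_log n]
      _ ≤ 2 * ((n : ℝ) + 1) ^ ε + ((n : ℝ) + 1) ^ ε / ε := by linarith
      _ = _ := by ring
  calc har n ^ k ≤ ((2 + 1 / ε) * ((n : ℝ) + 1) ^ ε) ^ k := pow_le_pow_left₀ (har_pos n).le h1 k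
    _ = (2 + 1 / ε) ^ k * ((n : ℝ) + 1) ^ (ε * k) := by
        rw [mul_pow, ← Real.rpow_natCast (((n : ℝ) + 1) ^ ε), ← Real.rpow_mul (by linarith)]
    _ ≤ _ := by
        refine mul_le_mul_of_nonneg_left (Real.rpow_le_rpow_of_exponent_le hn ?_) (by positivity)
        rw [hε, div_mul_eq_mul_div, one_mul, div_le_div_iff₀ (by positivity) (by norm_num)]
        linarith

theorem tendsto_har_pow_div (k : ℕ) :
    Filter.Tendsto (fun n : ℕ => har n ^ k / ((n : ℝ) + 1)) Filter.atTop (nhds 0) := by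
  obtain ⟨C, hC⟩ := exists_har_pow_le k
  have h1 : Filter.Tendsto (fun n : ℕ => C * ((n : ℝ) + 1) ^ (-(1 / 2 : ℝ))) Filter.atTop
      (nhds (C * 0)) :=
    ((tendsto_rpow_neg_atTop (by norm_num)).comp
      (Filter.tendsto_atTop_add_const_right _ 1 tendsto_natCast_atTop_atTop)).const_mul C
  rw [mul_zero] at h1
  refine squeeze_zero (fun n => by have := har_pos n; positivity) (fun n => ?_) h1
  have hn : (0 : ℝ) < (n : ℝ) + 1 := by positivity
  rw [div_le_iff₀ hn, mul_assoc, ← Real.rpow_add_one hn.ne']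
  refine (hC n).trans_eq ?_
  congr 2
  norm_num

theorem summable_har_pow_div_sq (k : ℕ) :
    Summable fun n : ℕ => har n ^ k / ((n : ℝ) + 1) ^ 2 := by
  obtain ⟨C, hC⟩ := exists_har_pow_le k
  have h1 : Summable fun n : ℕ => C * ((n : ℝ) + 1) ^ (-(3 / 2 : ℝ)) := by
    have h := ((summable_nat_add_iff 1).mpr
      (Real.summable_nat_rpow (p := -(3 / 2 : ℝ)).mpr (by norm_num))).mul_left C
    simpa using h
  refine Summable.of_nonneg_of_le (fun n => by have := har_pos n; positivity) (fun n => ?_) h1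
  have hn : (0 : ℝ) < (n : ℝ) + 1 := by positivity
  rw [div_le_iff₀ (by positivity), mul_assoc, ← Real.rpow_add_natCast hn.ne']
  refine (hC n).trans_eq ?_
  congr 2
  norm_num

/-- The inner sum has n terms, each at most 1/((n+1)²(N−n)). Since n/(n+1)² ≤ 1/(n+1), the identity
1/((n+1)(N−n)) = (1/(n+1) + 1/(N−n))/(N+1) leaves two harmonic sums, one of them reflected. -/
theorem sum_triangle_le (N : ℕ) :
    ∑ n ∈ Finset.range N, ∑ j ∈ Finset.Ico (N - n) N, 1 / (((n : ℝ) + 1) ^ 2 * ((j : ℝ) + 1)) ≤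
      2 * har N / ((N : ℝ) + 1) := by
  have h1 : ∀ n ∈ Finset.range N, ∑ j ∈ Finset.Ico (N - n) N,
      1 / (((n : ℝ) + 1) ^ 2 * ((j : ℝ) + 1)) ≤
      (1 / ((n : ℝ) + 1) + 1 / (((N - 1 - n : ℕ) : ℝ) + 1)) * (1 / ((N : ℝ) + 1)) := by
    intro n hn
    have hn' := Finset.mem_range.mp hn
    have hc : (((N - 1 - n : ℕ) : ℝ) + 1) = N - n := by
      have : N - 1 - n + 1 + n = N := by omega
      have h2 : ((N - 1 - n + 1 + n : ℕ) : ℝ) = N := by exact_mod_cast this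
      push_cast at h2
      linarith
    have hd : (0 : ℝ) < (N : ℝ) - n := by
      have : (n : ℝ) < N := by exact_mod_cast hn'
      linarith
    have hj : ∀ j ∈ Finset.Ico (N - n) N, 1 / (((n : ℝ) + 1) ^ 2 * ((j : ℝ) + 1)) ≤
        1 / (((n : ℝ) + 1) ^ 2 * ((N : ℝ) - n)) := by
      intro j hj
      have : ((N : ℝ) - n) ≤ j := by
        have h3 := (Finset.mem_Ico.mp hj).1
        have h4 : N ≤ j + n := by omega
        have h5 : (N : ℝ) ≤ j + n := by exact_mod_cast h4
        linarith
      gcongr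
      linarith
    refine (Finset.sum_le_card_nsmul _ _ _ hj).trans ?_
    have hcard : (Finset.Ico (N - n) N).card = n := by
      rw [Nat.card_Ico]; omega
    rw [hcard, hc, nsmul_eq_mul, div_add_div _ _ (by positivity) hd.ne', div_mul_div_comm,
      mul_one_div, div_le_div_iff₀ (by positivity) (by positivity)]
    have hn0 : (0 : ℝ) ≤ n := n.cast_nonneg
    have e : (1 * ((N : ℝ) - n) + ((n : ℝ) + 1) * 1) * 1 = (N : ℝ) + 1 := by ring
    rw [e]
    have : (n : ℝ) * ((n + 1) * (N - n) * (N + 1)) ≤ (n + 1) * ((n + 1) * (N - n) * (N + 1)) :=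
      mul_le_mul_of_nonneg_right (by linarith) (by positivity)
    nlinarith [this]
  refine (Finset.sum_le_sum h1).trans ?_
  rw [← Finset.sum_mul, Finset.sum_add_distrib,
    Finset.sum_range_reflect (fun n => 1 / ((n : ℝ) + 1)) N, mul_one_div]
  have := sum_har_le N
  gcongr
  linarith

/-! ### Growth classes and coefficientwise convergence -/

/-- `f n` is bounded coefficientwise by a power of `har n` divided by `(n + 1) ^ a`. -/
def Grow (a : ℕ) (f : ℕ → Ser) : Prop :=
  ∀ I D, ∃ (C : ℝ) (k : ℕ), 0 ≤ C ∧ ∀ n, nrm I D (f n) ≤ C * (har n ^ k / ((n : ℝ) + 1) ^ a)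

theorem Grow.mul {a b : ℕ} {f g : ℕ → Ser} (hf : Grow a f) (hg : Grow b g) :
    Grow (a + b) (fun n => f n * g n) := by
  intro I D
  obtain ⟨C, k, h0, h⟩ := hf I D
  obtain ⟨C', k', h0', h'⟩ := hg I D
  refine ⟨C * C', k + k', mul_nonneg h0 h0', fun n => ?_⟩
  calc _ ≤ _ := map_mul_le_mul _ _ _
    _ ≤ _ := mul_le_mul (h n) (h' n) (apply_nonneg _ _) ((apply_nonneg _ _).trans (h n))
    _ = _ := by rw [pow_add, pow_add]; ring

theorem har_pow_div_le {k k' a a' : ℕ} (hk : k ≤ k') (ha : a' ≤ a) (n : ℕ) :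
    har n ^ k / ((n : ℝ) + 1) ^ a ≤ har n ^ k' / ((n : ℝ) + 1) ^ a' := by
  have h1 := one_le_har n
  have h2 : (1 : ℝ) ≤ (n : ℝ) + 1 := by linarith [n.cast_nonneg (α := ℝ)]
  gcongr

theorem Grow.anti {a b : ℕ} {f : ℕ → Ser} (hf : Grow a f) (h : b ≤ a) : Grow b f := by
  intro I D
  obtain ⟨C, k, h0, h'⟩ := hf I D
  exact ⟨C, k, h0, fun n => (h' n).trans (mul_le_mul_of_nonneg_left (har_pow_div_le le_rfl h n) h0)⟩

theorem Grow.add {a : ℕ} {f g : ℕ → Ser} (hf : Grow a f) (hg : Grow a g) :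
    Grow a (fun n => f n + g n) := by
  intro I D
  obtain ⟨C, k, h0, h⟩ := hf I D
  obtain ⟨C', k', h0', h'⟩ := hg I D
  refine ⟨C + C', k + k', add_nonneg h0 h0', fun n => (map_add_le_add _ _ _).trans ?_⟩
  rw [add_mul]
  exact add_le_add
    ((h n).trans (mul_le_mul_of_nonneg_left (har_pow_div_le (by omega) le_rfl n) h0))
    ((h' n).trans (mul_le_mul_of_nonneg_left (har_pow_div_le (by omega) le_rfl n) h0'))

theorem grow_const (c : Ser) : Grow 0 (fun _ => c) := fun I D =>
  ⟨nrm I D c, 0, apply_nonneg _ _, fun n => by simp⟩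

theorem Grow.const_mul {a : ℕ} {f : ℕ → Ser} (c : Ser) (hf : Grow a f) :
    Grow a (fun n => c * f n) := by
  simpa using (grow_const c).mul hf

theorem Grow.sum {f : ℕ → Ser} (hf : Grow 1 f) : Grow 0 (fun n => ∑ j ∈ Finset.range n, f j) := by
  intro I D
  obtain ⟨C, k, h0, h⟩ := hf I D
  refine ⟨C, k + 1, h0, fun n => ((nrm I D).map_sum_le _ _).trans ?_⟩
  have hn := har_pos n
  calc _ ≤ ∑ j ∈ Finset.range n, C * har n ^ k * (1 / ((j : ℝ) + 1)) := by
        refine Finset.sum_le_sum fun j hj => (h j).trans ?_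
        have h1 := har_mono (Finset.mem_range.mp hj).le
        have h2 := har_pos j
        rw [mul_assoc, mul_one_div, pow_one]
        gcongr
    _ = C * har n ^ k * ∑ j ∈ Finset.range n, 1 / ((j : ℝ) + 1) := by rw [Finset.mul_sum]
    _ ≤ C * har n ^ k * har n := mul_le_mul_of_nonneg_left (sum_har_le n) (by positivity)
    _ = _ := by rw [pow_succ, pow_zero, div_one, mul_assoc]

/-- The square partial sums of the product of two series differ little from the triangular ones. -/
theorem Grow.sum_mul_sum_sub {f g : ℕ → Ser} (hf : Grow 2 f) (hg : Grow 1 g) :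
    Grow 1 (fun N => (∑ n ∈ Finset.range N, f n) * (∑ n ∈ Finset.range N, g n) -
      ∑ m ∈ Finset.range N, ∑ p ∈ antidiagonal m, f p.1 * g p.2) := by
  intro I D
  obtain ⟨C, k, h0, h⟩ := hf I D
  obtain ⟨C', k', h0', h'⟩ := hg I D
  refine ⟨2 * (C * C'), k + k' + 1, by positivity, fun N => ?_⟩
  have e : (∑ n ∈ Finset.range N, f n) * (∑ n ∈ Finset.range N, g n) -
      ∑ m ∈ Finset.range N, ∑ p ∈ antidiagonal m, f p.1 * g p.2 =
      ∑ n ∈ Finset.range N, ∑ j ∈ Finset.Ico (N - n) N, f n * g j := by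
    rw [sum_range_sum_antidiagonal (fun i j => f i * g j), Finset.sum_mul_sum,
      ← Finset.sum_sub_distrib]
    refine Finset.sum_congr rfl fun n _ => ?_
    rw [Finset.sum_Ico_eq_sub _ (Nat.sub_le N n)]
  refine (congrArg (nrm I D) e).trans_le ?_
  have hN := har_pos N
  calc _ ≤ ∑ n ∈ Finset.range N, ∑ j ∈ Finset.Ico (N - n) N, C * C' * har N ^ (k + k') *
          (1 / (((n : ℝ) + 1) ^ 2 * ((j : ℝ) + 1))) := by
        refine ((nrm I D).map_sum_le _ _).trans (Finset.sum_le_sum fun n hn =>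
          ((nrm I D).map_sum_le _ _).trans (Finset.sum_le_sum fun j hj => ?_))
        have h1 := har_mono (Finset.mem_range.mp hn).le
        have h2 := har_mono (Finset.mem_Ico.mp hj).2.le
        have h3 := har_pos n
        have h4 := har_pos j
        calc _ ≤ _ := map_mul_le_mul _ _ _
          _ ≤ _ := mul_le_mul (h n) (h' j) (apply_nonneg _ _) ((apply_nonneg _ _).trans (h n))
          _ ≤ (C * (har N ^ k / ((n : ℝ) + 1) ^ 2)) * (C' * (har N ^ k' / ((j : ℝ) + 1) ^ 1)) := by
              gcongr
          _ = _ := by rw [pow_add]; field_simp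
    _ = C * C' * har N ^ (k + k') * ∑ n ∈ Finset.range N, ∑ j ∈ Finset.Ico (N - n) N,
          1 / (((n : ℝ) + 1) ^ 2 * ((j : ℝ) + 1)) := by simp only [Finset.mul_sum]
    _ ≤ C * C' * har N ^ (k + k') * (2 * har N / ((N : ℝ) + 1)) :=
        mul_le_mul_of_nonneg_left (sum_triangle_le N) (by positivity)
    _ = _ := by rw [pow_succ, pow_one]; ring

/-- Coefficientwise convergence. -/
def Conv (f : ℕ → Ser) (a : Ser) : Prop :=
  ∀ i d, Filter.Tendsto (fun n => co i d (f n)) Filter.atTop (nhds (co i d a))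

theorem Conv.unique {f : ℕ → Ser} {a b : Ser} (h : Conv f a) (h' : Conv f b) : a = b :=
  Ser.ext fun i d => tendsto_nhds_unique (h i d) (h' i d)

theorem conv_const (a : Ser) : Conv (fun _ => a) a := fun _ _ => tendsto_const_nhds

theorem Conv.add {f g : ℕ → Ser} {a b : Ser} (h : Conv f a) (h' : Conv g b) :
    Conv (fun n => f n + g n) (a + b) := fun i d => by
  simpa only [map_add] using (h i d).add (h' i d)

theorem Conv.sub {f g : ℕ → Ser} {a b : Ser} (h : Conv f a) (h' : Conv g b) :
    Conv (fun n => f n - g n) (a - b) := fun i d => by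
  simpa only [map_sub] using (h i d).sub (h' i d)

theorem Conv.mul {f g : ℕ → Ser} {a b : Ser} (h : Conv f a) (h' : Conv g b) :
    Conv (fun n => f n * g n) (a * b) := fun i d => by
  simp only [co_mul]
  exact tendsto_finsetSum _ fun p _ => tendsto_finsetSum _ fun q _ => (h _ _).mul (h' _ _)

theorem Conv.congr {f g : ℕ → Ser} {a : Ser} (h : Conv f a) (e : ∀ n, f n = g n) : Conv g a := by
  rwa [← funext e]

theorem Conv.comp_succ {f : ℕ → Ser} {a : Ser} (h : Conv f a) : Conv (fun n => f (n + 1)) a :=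
  fun i d => (h i d).comp (Filter.tendsto_add_atTop_nat 1)

theorem Grow.conv_zero {f : ℕ → Ser} (h : Grow 1 f) : Conv f 0 := by
  intro i d
  obtain ⟨C, k, -, h'⟩ := h (i + 1) (d + 1)
  rw [map_zero]
  have h1 := (tendsto_har_pow_div k).const_mul C
  rw [mul_zero] at h1
  exact squeeze_zero_norm (fun n => (norm_co_le i d _).trans (by simpa using h' n)) h1

theorem Grow.summable_nrm {f : ℕ → Ser} (h : Grow 2 f) (I D : ℕ) :
    Summable fun n => nrm I D (f n) := by
  obtain ⟨C, k, -, h'⟩ := h I D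
  exact Summable.of_nonneg_of_le (fun _ => apply_nonneg _ _) h'
    ((summable_har_pow_div_sq k).mul_left C)

theorem Grow.summable_co {f : ℕ → Ser} (h : Grow 2 f) (i d : ℕ) :
    Summable fun n => co i d (f n) :=
  Summable.of_norm_bounded (h.summable_nrm (i + 1) (d + 1)) fun _ => norm_co_le i d _

/-- The coefficientwise sum of a series. -/
noncomputable def serSum (f : ℕ → Ser) : Ser :=
  PowerSeries.mk fun i => PowerSeries.mk fun d => ∑' n, co i d (f n)

theorem co_serSum (f : ℕ → Ser) (i d : ℕ) : co i d (serSum f) = ∑' n, co i d (f n) := by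
  simp [co_apply, serSum]

theorem Grow.conv_serSum {f : ℕ → Ser} (h : Grow 2 f) :
    Conv (fun N => ∑ n ∈ Finset.range N, f n) (serSum f) := by
  intro i d
  simp only [map_sum, co_serSum]
  exact (h.summable_co i d).hasSum.tendsto_sum_nat

theorem Conv.sum_antidiagonal {f g : ℕ → Ser} (hf : Grow 2 f) (hg : Grow 2 g) :
    Conv (fun N => ∑ m ∈ Finset.range N, ∑ p ∈ antidiagonal m, f p.1 * g p.2)
      (serSum f * serSum g) := by
  have h := (hf.conv_serSum.mul hg.conv_serSum).sub
    (hf.sum_mul_sum_sub (hg.anti one_le_two)).conv_zero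
  simpa using h

/-! ### The hypergeometric identity, coefficient by coefficient -/

/-- The scalars of `Ser`. -/
noncomputable def cc : ℂ →+* Ser := (PowerSeries.C (R := PowerSeries ℂ)).comp PowerSeries.C

/-- The inverse of `n + 1 - y * t`. -/
noncomputable def uu (y : ℂ) (n : ℕ) : Ser :=
  PowerSeries.C (PowerSeries.mk fun d => y ^ d / ((n : ℂ) + 1) ^ (d + 1))

/-- The inverse of `n + 1 - s * z`. -/
noncomputable def iz (s : ℂ) (n : ℕ) : Ser :=
  PowerSeries.mk fun i => PowerSeries.C (s ^ i / ((n : ℂ) + 1) ^ (i + 1))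

theorem PowerSeries.mk_pow_div_mul {K : Type*} [Field K] (y a : K) (ha : a ≠ 0) :
    (PowerSeries.mk fun d => y ^ d / a ^ (d + 1)) * (PowerSeries.C a - PowerSeries.C y * PowerSeries.X)
      = 1 := by
  ext d
  rw [mul_sub, mul_comm _ (PowerSeries.C a), mul_comm _ (PowerSeries.C y * PowerSeries.X), mul_assoc]
  cases d with
  | zero => simp [ha]
  | succ d =>
    simp only [map_sub, PowerSeries.coeff_C_mul, PowerSeries.coeff_succ_X_mul,
      PowerSeries.coeff_mk, PowerSeries.coeff_one]
    rw [if_neg (Nat.succ_ne_zero d)]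
    field_simp
    ring

theorem uu_mul (y : ℂ) (n : ℕ) : uu y n * ((n : Ser) + 1 - tt y) = 1 := by
  have h := PowerSeries.mk_pow_div_mul y ((n : ℂ) + 1) (by exact_mod_cast n.succ_ne_zero)
  have h' := congrArg (PowerSeries.C (R := PowerSeries ℂ)) h
  simpa [uu, tt] using h'

theorem iz_mul (s : ℂ) (n : ℕ) : iz s n * ((n : Ser) + 1 - zz s) = 1 := by
  have h := PowerSeries.mk_pow_div_mul s ((n : ℂ) + 1) (by exact_mod_cast n.succ_ne_zero)
  have h' := congrArg (PowerSeries.map (PowerSeries.C (R := ℂ))) h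
  rw [map_mul, map_one] at h'
  convert h' using 2
  · ext i : 1
    simp [iz]
  · simp [zz]

theorem tt_zero : tt 0 = 0 := by simp [tt]

theorem tt_add (x y : ℂ) : tt (x + y) = tt x + tt y := by simp [tt, add_mul]

theorem zz_neg (s : ℂ) : zz (-s) = -zz s := by simp [zz]

theorem uu_zero_mul (n : ℕ) : uu 0 n * ((n : Ser) + 1) = 1 := by
  simpa [tt_zero] using uu_mul 0 n

theorem uu_sub_uu_zero (y : ℂ) (n : ℕ) : uu y n - uu 0 n = tt y * (uu 0 n * uu y n) := by
  linear_combination (-uu y n) * uu_zero_mul n + uu 0 n * uu_mul y n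

/-- Partial fractions: the denominators n+1−yt and p+1−xt add up to n+p+2−(x+y)t. This is where the
parameter x+y comes from. -/
theorem uu_mul_uu (x y : ℂ) (n p : ℕ) :
    uu y n * uu x p = uu (x + y) (n + p + 1) * (uu y n + uu x p) := by
  have h1 := uu_mul y n
  have h2 := uu_mul x p
  have h3 := uu_mul (x + y) (n + p + 1)
  rw [tt_add] at h3
  push_cast at h3
  linear_combination (-(uu y n * uu x p)) * h3 + uu (x + y) (n + p + 1) * uu x p * h1 +
    uu (x + y) (n + p + 1) * uu y n * h2

/-- The product of `1 + s * z / (j - y * t)` over `1 ≤ j ≤ n`. -/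
noncomputable def QQ (y s : ℂ) (n : ℕ) : Ser := ∏ j ∈ Finset.range n, (1 + zz s * uu y j)

theorem QQ_zero (y s : ℂ) : QQ y s 0 = 1 := by simp [QQ]

theorem QQ_succ (y s : ℂ) (n : ℕ) : QQ y s (n + 1) = QQ y s n * (1 + zz s * uu y n) :=
  Finset.prod_range_succ _ _

/-- After partial fractions the factor 1/(n+p+2−(x+y)t) is constant along the antidiagonal. What
remains telescopes, because sz times the reciprocal of n+1−yt, times Q(n), is Q(n+1) − Q(n); the
opposite sign of `s` in the second factor makes the two differences match. -/
theorem zz_mul_sum_antidiagonal (x y s : ℂ) (m : ℕ) :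
    zz s * ∑ p ∈ antidiagonal m, (uu y p.1 * QQ y s p.1) * (uu x p.2 * QQ x (-s) p.2) =
      uu (x + y) (m + 1) * (QQ y s (m + 1) - QQ x (-s) (m + 1)) := by
  have h : ∀ p ∈ antidiagonal m, (uu y p.1 * QQ y s p.1) * (uu x p.2 * QQ x (-s) p.2) * zz s =
      uu (x + y) (m + 1) * (QQ y s (p.1 + 1) * QQ x (-s) p.2 - QQ y s p.1 * QQ x (-s) (p.2 + 1)) := by
    rintro ⟨n, p⟩ hp
    rw [Finset.HasAntidiagonal.mem_antidiagonal] at hp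
    subst hp
    simp only [QQ_succ, zz_neg]
    linear_combination QQ y s n * QQ x (-s) p * zz s * uu_mul_uu x y n p
  rw [mul_comm, Finset.sum_mul, Finset.sum_congr rfl h, ← Finset.mul_sum, Finset.sum_sub_distrib]
  congr 1
  -- The same convolution of length m+2 is peeled at either end; comparing the two leaves only the
  -- boundary terms.
  have e1 : ∑ p ∈ antidiagonal (m + 1), QQ y s p.1 * QQ x (-s) p.2 =
      QQ x (-s) (m + 1) + ∑ p ∈ antidiagonal m, QQ y s (p.1 + 1) * QQ x (-s) p.2 := by
    rw [Finset.Nat.sum_antidiagonal_succ, QQ_zero, one_mul]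
  have e2 : ∑ p ∈ antidiagonal (m + 1), QQ y s p.1 * QQ x (-s) p.2 =
      QQ y s (m + 1) + ∑ p ∈ antidiagonal m, QQ y s p.1 * QQ x (-s) (p.2 + 1) := by
    rw [Finset.Nat.sum_antidiagonal_succ', QQ_zero, mul_one]
  linear_combination e2 - e1

/-- The coefficients of `∑ QQ y s n * S ^ n` divided by `∑ QQ 0 s n * S ^ n`. -/
noncomputable def bb (y s : ℂ) : ℕ → Ser
  | 0 => 1
  | n + 1 => zz s * (uu y n - uu 0 n) * QQ 0 (-s) n

theorem natCast_add_one_mul_QQ_zero_succ (s : ℂ) (n : ℕ) :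
    ((n : Ser) + 1) * QQ 0 s (n + 1) = ((n : Ser) + 1 + zz s) * QQ 0 s n := by
  rw [QQ_succ]
  linear_combination QQ 0 s n * zz s * uu_zero_mul n

theorem PowerSeries.derivative_mul {R : Type*} [CommRing R] (f g : PowerSeries R) :
    derivative R (f * g) = f * derivative R g + g * derivative R f :=
  (derivative R).leibniz f g

-- This is the differential equation of the binomial series (1−X)^{−1−sz}.
open PowerSeries in
theorem one_sub_X_mul_derivative_QQ_zero (s : ℂ) :
    (1 - X) * derivative Ser (mk (QQ 0 s)) = C (1 + zz s) * mk (QQ 0 s) := by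
  ext n : 1
  rw [sub_mul, one_mul, map_sub, coeff_C_mul, coeff_mk]
  have h := natCast_add_one_mul_QQ_zero_succ s n
  cases n with
  | zero =>
    rw [coeff_zero_X_mul, coeff_derivative, coeff_mk]
    linear_combination h
  | succ n =>
    rw [coeff_succ_X_mul, coeff_derivative, coeff_derivative, coeff_mk, coeff_mk]
    push_cast at h ⊢
    linear_combination h

-- The exponents −1−sz and −1+sz add up to −2. Formally, the derivative vanishes by the two
-- differential equations and the constant term is 1.
open PowerSeries in
theorem one_sub_X_sq_mul_QQ_zero (s : ℂ) :
    (1 - X) ^ 2 * mk (QQ 0 s) * mk (QQ 0 (-s)) = 1 := by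
  have h1 := one_sub_X_mul_derivative_QQ_zero s
  have h2 := one_sub_X_mul_derivative_QQ_zero (-s)
  rw [zz_neg] at h2
  have : IsAddTorsionFree Ser := .of_isTorsionFree ℚ Ser
  refine derivative.ext ?_ ?_
  · rw [derivative_mul, derivative_mul, sq, derivative_mul, map_sub, derivative_one, derivative_X]
    simp only [map_add, map_neg, map_one] at *
    linear_combination (1 - X) * mk (QQ 0 s) * h2 + (1 - X) * mk (QQ 0 (-s)) * h1
  · simp [QQ_zero]

-- Euler's transformation, with the factor (1−X)^{−1−sz} represented by `mk (QQ 0 s)`. The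
-- right-hand side satisfies a first-order differential equation whose coefficients give the
-- recursion (n+1−yt)F_{n+1} = (n+1−yt+sz)F_n that defines `QQ`.
open PowerSeries in
theorem mk_QQ_eq (y s : ℂ) : mk (QQ y s) = mk (QQ 0 s) * mk (bb y s) := by
  have hb : X * derivative Ser (mk (bb y s)) =
      C (tt y) * mk (bb y s) - C (tt y) * ((1 - X) * mk (QQ 0 (-s))) := by
    ext n : 1
    rw [map_sub, coeff_C_mul, coeff_C_mul, sub_mul, one_mul, map_sub, coeff_mk, coeff_mk]
    cases n with
    | zero => simp [bb, QQ_zero]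
    | succ n =>
      rw [coeff_succ_X_mul, coeff_succ_X_mul, coeff_derivative, coeff_mk, coeff_mk, QQ_succ, zz_neg]
      simp only [bb]
      rw [uu_sub_uu_zero]
      linear_combination zz s * tt y * uu 0 n * QQ 0 (-s) n * uu_mul y n
  have h0 := one_sub_X_mul_derivative_QQ_zero s
  have h1 := one_sub_X_sq_mul_QQ_zero s
  set F := mk (QQ 0 s) * mk (bb y s) with hF
  -- The inverse relation between `QQ 0 s` and `QQ 0 (-s)` turns the inhomogeneous term of `hb` into
  -- the constant `tt y`, which affects only the coefficient of degree 0.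
  have ode : X * derivative Ser F - X * (X * derivative Ser F) =
      C (tt y) * F + C (1 - tt y + zz s) * (X * F) - C (tt y) := by
    rw [hF, derivative_mul]
    simp only [map_add, map_sub, map_one] at *
    linear_combination (1 - X) * mk (QQ 0 s) * hb + X * mk (bb y s) * h0 - C (tt y) * h1
  ext n : 1
  rw [coeff_mk]
  induction n with
  | zero => simp [hF, QQ_zero, bb]
  | succ n ih =>
    have h := congrArg (coeff (n + 1)) ode
    rw [map_sub, map_sub, map_add, coeff_succ_X_mul, coeff_succ_X_mul, coeff_C_mul, coeff_C_mul,
      coeff_succ_X_mul, coeff_derivative, coeff_C, if_neg (Nat.succ_ne_zero n)] at h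
    have h' : (n : Ser) * coeff n F = coeff n (X * derivative Ser F) := by
      cases n with
      | zero => simp
      | succ n => rw [coeff_succ_X_mul, coeff_derivative]; push_cast; ring
    rw [← h', ← ih] at h
    rw [QQ_succ]
    linear_combination (coeff (n + 1) F - QQ y s n) * uu_mul y n - uu y n * h

open PowerSeries in
theorem one_sub_X_mul_mk_QQ (y s : ℂ) :
    (1 - X) * mk (QQ y s) = 1 + X * (C (zz s) * mk fun n => uu y n * QQ y s n) := by
  ext n : 1
  rw [sub_mul, one_mul, map_sub, map_add, coeff_mk]
  cases n with
  | zero => simp [QQ_zero]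
  | succ n =>
    rw [coeff_succ_X_mul, coeff_succ_X_mul, coeff_C_mul, coeff_mk, coeff_mk, QQ_succ, coeff_one,
      if_neg (Nat.succ_ne_zero n)]
    ring

-- The binomial factors of opposite exponent disappear, leaving the product of two series 1 + X(…),
-- whose linear terms are explicit and whose cross term is the convolution already evaluated.
open PowerSeries in
theorem sum_antidiagonal_bb (x y s : ℂ) (m : ℕ) :
    ∑ p ∈ antidiagonal (m + 1), bb y s p.1 * bb x (-s) p.2 =
      zz s * (uu y m * QQ y s m) - zz s * (uu x m * QQ x (-s) m) -
        zz s * (uu (x + y) m * (QQ y s m - QQ x (-s) m)) := by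
  have h : mk (bb y s) * mk (bb x (-s)) = ((1 - X) * mk (QQ y s)) * ((1 - X) * mk (QQ x (-s))) := by
    have h1 := one_sub_X_sq_mul_QQ_zero s
    rw [mk_QQ_eq y s, mk_QQ_eq x (-s)]
    linear_combination (-(mk (bb y s) * mk (bb x (-s)))) * h1
  rw [one_sub_X_mul_mk_QQ, one_sub_X_mul_mk_QQ, zz_neg] at h
  set q := mk fun n => uu y n * QQ y s n with hq
  set r := mk fun n => uu x n * QQ x (-s) n with hr
  have h' : mk (bb y s) * mk (bb x (-s)) = 1 + X * (C (zz s) * q) - X * (C (zz s) * r) -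
      X * (X * (C (zz s) * (C (zz s) * (q * r)))) := by
    rw [h, map_neg]; ring
  have e := congrArg (coeff (m + 1)) h'
  rw [coeff_mul] at e
  simp only [coeff_mk] at e
  rw [e]
  simp only [map_sub, map_add, coeff_succ_X_mul, coeff_C_mul, hq, hr, coeff_mk, coeff_one,
      if_neg (Nat.succ_ne_zero m)]
  -- For m = 0 there is no cross term, in accordance with the vanishing of `QQ y s 0 - QQ x (-s) 0`.
  cases m with
  | zero => simp [QQ_zero]
  | succ m =>
    rw [coeff_succ_X_mul, coeff_C_mul, coeff_C_mul, coeff_mul]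
    simp only [coeff_mk]
    rw [zz_mul_sum_antidiagonal]
    ring

/-- The terms with `uu 0 m` cancel between the two sides. They are inserted so that each summand has
size 1/m² up to logarithms and can be summed separately. -/
theorem zz_mul_main (x y s : ℂ) (m : ℕ) :
    zz s * ((uu (x + y) m - uu 0 m) * QQ y s m - (uu (x + y) m - uu 0 m) * QQ x (-s) m) =
      zz s * ((uu y m - uu 0 m) * QQ y s m) - zz s * ((uu x m - uu 0 m) * QQ x (-s) m) -
        ∑ p ∈ antidiagonal (m + 1), bb y s p.1 * bb x (-s) p.2 := by
  rw [sum_antidiagonal_bb]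
  ring

/-! ### Growth of the factors and summation of the identity -/

theorem Grow.of_succ {a : ℕ} {f : ℕ → Ser} (h : Grow a (fun n => f (n + 1))) : Grow a f := by
  intro I D
  obtain ⟨C, k, h0, h'⟩ := h I D
  refine ⟨nrm I D (f 0) + C * 2 ^ a, k, add_nonneg (apply_nonneg _ _) (by positivity), fun n => ?_⟩
  cases n with
  | zero =>
    have e : har 0 ^ k / (((0 : ℕ) : ℝ) + 1) ^ a = 1 := by simp [har]
    rw [e, mul_one]
    exact le_add_of_nonneg_right (by positivity)
  | succ n =>
    have h1 := har_pos n
    have h2 := har_mono n.le_succ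
    have h3 := har_pos (n + 1)
    have h4 : (((n + 1 : ℕ) : ℝ) + 1) ≤ 2 * ((n : ℝ) + 1) := by
      push_cast; linarith [n.cast_nonneg (α := ℝ)]
    have h5 : 1 / ((n : ℝ) + 1) ^ a ≤ 2 ^ a / (((n + 1 : ℕ) : ℝ) + 1) ^ a := by
      rw [div_le_div_iff₀ (by positivity) (by positivity), one_mul, ← mul_pow]
      exact pow_le_pow_left₀ (by positivity) h4 a
    calc _ ≤ _ := h' n
      _ = C * (har n ^ k * (1 / ((n : ℝ) + 1) ^ a)) := by rw [mul_one_div]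
      _ ≤ C * (har (n + 1) ^ k * (2 ^ a / (((n + 1 : ℕ) : ℝ) + 1) ^ a)) := by gcongr
      _ = (C * 2 ^ a) * (har (n + 1) ^ k / (((n + 1 : ℕ) : ℝ) + 1) ^ a) := by ring
      _ ≤ _ := mul_le_mul_of_nonneg_right (le_add_of_nonneg_left (apply_nonneg _ _)) (by positivity)

theorem nrm_cc_mul_le (I D : ℕ) (c : ℂ) (f : Ser) : nrm I D (cc c * f) ≤ ‖c‖ * nrm I D f := by
  refine (map_mul_le_mul _ _ _).trans (mul_le_mul_of_nonneg_right ?_ (apply_nonneg _ _))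
  exact (RingSeminorm.powerSeries_C_le _ _ _).trans (RingSeminorm.powerSeries_C_le _ _ _)

/-- The constant in the bound `nrm_uu_le`. -/
noncomputable def uuBound (D : ℕ) (y : ℂ) : ℝ := ∑ d ∈ Finset.range D, ‖y‖ ^ d

theorem uuBound_nonneg (D : ℕ) (y : ℂ) : 0 ≤ uuBound D y :=
  Finset.sum_nonneg fun _ _ => by positivity

theorem uuBound_mono (y : ℂ) : Monotone fun D => uuBound D y := fun _ _ h =>
  Finset.sum_le_sum_of_subset_of_nonneg (Finset.range_mono h) fun _ _ _ => by positivity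

theorem norm_natCast_add_one (n : ℕ) : ‖(n : ℂ) + 1‖ = (n : ℝ) + 1 := by
  exact_mod_cast Complex.norm_natCast (n + 1)

theorem nrm_uu_le (I D : ℕ) (y : ℂ) (n : ℕ) : nrm I D (uu y n) ≤ uuBound D y / ((n : ℝ) + 1) := by
  refine (RingSeminorm.powerSeries_C_le _ _ _).trans ?_
  rw [RingSeminorm.powerSeries_apply, uuBound, Finset.sum_div]
  refine Finset.sum_le_sum fun d _ => ?_
  rw [PowerSeries.coeff_mk]
  change ‖(_ : ℂ)‖ ≤ _
  have h1 : (1 : ℝ) ≤ (n : ℝ) + 1 := by linarith [n.cast_nonneg (α := ℝ)]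
  rw [norm_div, norm_pow, norm_pow, norm_natCast_add_one]
  gcongr
  exact le_self_pow₀ h1 (Nat.succ_ne_zero d)

theorem grow_uu (y : ℂ) : Grow 1 (uu y) := fun I D =>
  ⟨uuBound D y, 0, uuBound_nonneg D y, fun n => (nrm_uu_le I D y n).trans_eq (by simp [div_eq_mul_inv])⟩

theorem grow_uu_sub (y : ℂ) : Grow 2 (fun n => uu y n - uu 0 n) := by
  simp only [uu_sub_uu_zero]
  exact ((grow_uu 0).mul (grow_uu y)).const_mul (tt y)

theorem grow_QQ (y s : ℂ) : Grow 0 (QQ y s) := fun I D =>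
  ⟨(1 + ‖s‖ * uuBound D y) ^ I, I, by have := uuBound_nonneg D y; positivity, fun n => by
    rw [pow_zero, div_one, ← mul_pow]
    exact RingSeminorm.prod_one_add_le (fun I => nrm I D) (fun K => nrm_one_le K D)
      (nrm_zero_left D) (norm_nonneg s) (uuBound_nonneg D y) (fun K => nrm_zz_mul_le K D s) I
      (fun K _ j => nrm_uu_le K D y j) n⟩

theorem grow_bb (y s : ℂ) : Grow 2 (bb y s) :=
  Grow.of_succ (((grow_uu_sub y).const_mul (zz s)).mul (grow_QQ 0 (-s)))

theorem grow_term (w y s : ℂ) : Grow 2 (fun m => (uu w m - uu 0 m) * QQ y s m) :=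
  (grow_uu_sub w).mul (grow_QQ y s)

/-- The generating function of the weighted sums. -/
noncomputable def genSum (w y s : ℂ) : Ser := serSum fun m => (uu w m - uu 0 m) * QQ y s m

theorem zz_mul_genSum_sub (x y s : ℂ) :
    zz s * (genSum (x + y) y s - genSum (x + y) x (-s)) =
      zz s * genSum y y s - zz s * genSum x x (-s) -
        (serSum (bb y s) * serSum (bb x (-s)) - 1) := by
  have h1 := (conv_const (zz s)).mul
    ((grow_term (x + y) y s).conv_serSum.sub (grow_term (x + y) x (-s)).conv_serSum)
  have h2 := (((conv_const (zz s)).mul (grow_term y y s).conv_serSum).sub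
    ((conv_const (zz s)).mul (grow_term x x (-s)).conv_serSum)).sub
    (((Conv.sum_antidiagonal (grow_bb y s) (grow_bb x (-s))).comp_succ).sub (conv_const 1))
  refine h1.unique (h2.congr fun N => ?_)
  rw [Finset.sum_range_succ']
  -- The coefficient identity starts in degree 1, so the degree 0 term of the product is removed; it
  -- accounts for the −1.
  have e : ∑ p ∈ antidiagonal 0, bb y s p.1 * bb x (-s) p.2 = 1 := by simp [bb]
  rw [e, add_sub_cancel_right, ← Finset.sum_sub_distrib, Finset.mul_sum, Finset.mul_sum, Finset.mul_sum,
    ← Finset.sum_sub_distrib, ← Finset.sum_sub_distrib]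
  exact Finset.sum_congr rfl fun m _ => (zz_mul_main x y s m).symm

/-! ### The sum formula -/

/-- The product of `(j - y * t) / (k + j - y * t)` over `1 ≤ j ≤ m`. -/
noncomputable def conn (y : ℂ) (m k : ℕ) : Ser :=
  ∏ j ∈ Finset.range m, ((j : Ser) + 1 - tt y) * uu y (k + j)

theorem conn_succ_right (y : ℂ) (m k : ℕ) :
    conn y (m + 1) k = ((m : Ser) + 1 - tt y) * uu y k * conn y m (k + 1) := by
  simp only [conn, Finset.prod_mul_distrib]
  rw [Finset.prod_range_succ, Finset.prod_range_succ' (fun j => uu y (k + j))]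
  have : ∏ j ∈ Finset.range m, uu y (k + (j + 1)) = ∏ j ∈ Finset.range m, uu y (k + 1 + j) :=
    Finset.prod_congr rfl fun j _ => by congr 1; omega
  rw [this, add_zero]
  ring

theorem conn_zero_right (y : ℂ) (m : ℕ) : conn y m 0 = 1 :=
  Finset.prod_eq_one fun j _ => by rw [zero_add, mul_comm, uu_mul]

/-- The transport relation of the connected sum: moving the connector from k to k+1 changes the
summand by a difference in m. This allows the sum over m to collapse for each k. -/
theorem conn_telescope (y s : ℂ) (m k : ℕ) :
    uu 0 m * uu y m * QQ y s m * conn y (m + 1) k -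
        uu 0 m * uu y m * QQ y s m * conn y (m + 1) (k + 1) =
      QQ y s m * conn y m (k + 1) * (uu y k * iz s k) -
        QQ y s (m + 1) * conn y (m + 1) (k + 1) * (uu y k * iz s k) := by
  have h : conn y (m + 1) (k + 1) = conn y m (k + 1) * (((m : Ser) + 1 - tt y) * uu y (k + 1 + m)) :=
    Finset.prod_range_succ _ _
  rw [h, conn_succ_right, QQ_succ]
  have h0 := uu_zero_mul m
  have h1 := uu_mul y m
  have h2 := uu_mul y k
  have h3 := uu_mul y (k + 1 + m)
  have h4 := iz_mul s k
  push_cast at h3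
  set a := uu 0 m
  set u := uu y m
  set v := uu y k
  set w := uu y (k + 1 + m)
  set g := iz s k
  set Y := tt y
  set Z := zz s
  set q := QQ y s m
  set c := conn y m (k + 1)
  have e1 : v - w = v * w * ((m : Ser) + 1) := by linear_combination w * h2 - v * h3
  have e2 : u * ((m : Ser) + 1 - Y) * (v - w) * a = v * w := by
    rw [h1, e1]; linear_combination v * w * h0
  have e3 : g * (1 - (1 + Z * u) * (((m : Ser) + 1 - Y) * w)) = w := by
    linear_combination (-g) * h3 - Z * w * g * h1 + w * h4
  linear_combination q * c * e2 - q * c * v * e3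

/-- The product of `j / (k + j)` over `1 ≤ j ≤ m`. -/
noncomputable def invChoose (m k : ℕ) : ℝ :=
  ∏ j ∈ Finset.range m, ((j : ℝ) + 1) / ((k : ℝ) + j + 1)

theorem invChoose_nonneg (m k : ℕ) : 0 ≤ invChoose m k :=
  Finset.prod_nonneg fun _ _ => by positivity

theorem invChoose_succ_le (m k : ℕ) : invChoose (m + 1) k ≤ 1 / ((k : ℝ) + 1) := by
  rw [invChoose, Finset.prod_range_succ']
  have h : ∏ j ∈ Finset.range m, (((j + 1 : ℕ) : ℝ) + 1) / ((k : ℝ) + (j + 1 : ℕ) + 1) ≤ 1 :=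
    Finset.prod_le_one (fun _ _ => by positivity) fun j _ => by
      rw [div_le_one (by positivity)]
      linarith [k.cast_nonneg (α := ℝ)]
  calc _ ≤ 1 * ((((0 : ℕ) : ℝ) + 1) / ((k : ℝ) + (0 : ℕ) + 1)) :=
        mul_le_mul_of_nonneg_right h (by positivity)
    _ = _ := by simp

theorem invChoose_succ_right_le (m k : ℕ) : invChoose m (k + 1) ≤ 1 / ((m : ℝ) + 1) := by
  induction m with
  | zero => simp [invChoose]
  | succ m ih =>
    rw [invChoose, Finset.prod_range_succ, ← invChoose]
    calc _ ≤ 1 / ((m : ℝ) + 1) * (((m : ℝ) + 1) / (((k + 1 : ℕ) : ℝ) + m + 1)) :=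
          mul_le_mul_of_nonneg_right ih (by positivity)
      _ = 1 / (((k + 1 : ℕ) : ℝ) + m + 1) := by field_simp
      _ ≤ _ := by
          refine one_div_le_one_div_of_le (by positivity) ?_
          push_cast
          linarith [k.cast_nonneg (α := ℝ)]

theorem uu_zero_eq (n : ℕ) : uu 0 n = cc (1 / ((n : ℂ) + 1)) := by
  have h : cc (1 / ((n : ℂ) + 1)) * ((n : Ser) + 1) = 1 := by
    have e : ((n : Ser) + 1) = cc ((n : ℂ) + 1) := by rw [map_add, map_natCast, map_one]
    have : ((n : ℂ) + 1) ≠ 0 := by exact_mod_cast n.succ_ne_zero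
    rw [e, ← map_mul, one_div_mul_cancel this, map_one]
  linear_combination uu 0 n * (-h) + cc (1 / ((n : ℂ) + 1)) * uu_zero_mul n

/-- Each factor is (j+1)/(k+j+1) times 1 − yt·k/((j+1)(k+j+1−yt)). The scalar part, a reciprocal
binomial coefficient, carries the decay. The correction is O(1/(j+1)) uniformly in k because
k/(k+j+1) ≤ 1, so it costs only logarithms of m. -/
theorem conn_eq (y : ℂ) (m k : ℕ) : conn y m k = cc (invChoose m k : ℝ) *
    ∏ j ∈ Finset.range m, (1 + tt y * (cc (-(k : ℂ) * (1 / ((j : ℂ) + 1))) * uu y (k + j))) := by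
  rw [invChoose, Complex.ofReal_prod, map_prod, ← Finset.prod_mul_distrib]
  refine Finset.prod_congr rfl fun j _ => ?_
  have e : cc ((((j : ℝ) + 1) / ((k : ℝ) + j + 1) : ℝ) : ℂ) = ((j : Ser) + 1) * uu 0 (k + j) := by
    rw [uu_zero_eq, ← map_natCast cc j, ← map_one cc, ← map_add, ← map_mul]
    push_cast
    rw [mul_one_div]
  rw [e, map_mul, ← uu_zero_eq, map_neg, map_natCast]
  have h1 := uu_zero_mul j
  have h2 := uu_zero_mul (k + j)
  have h3 := uu_mul y (k + j)
  push_cast at h2 h3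
  linear_combination (uu 0 (k + j) * tt y * k * uu y (k + j)) * h1 + tt y * uu y (k + j) * h2 -
    ((j : Ser) + 1) * (uu y (k + j) * h2 - uu 0 (k + j) * h3)

theorem nrm_conn_le (I D : ℕ) (y : ℂ) (m k : ℕ) : nrm I D (conn y m k) ≤
    invChoose m k * ((1 + ‖y‖ * uuBound D y) * har m) ^ D := by
  rw [conn_eq]
  refine (nrm_cc_mul_le _ _ _ _).trans ?_
  rw [Complex.norm_of_nonneg (invChoose_nonneg m k)]
  refine mul_le_mul_of_nonneg_left ?_ (invChoose_nonneg m k)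
  refine RingSeminorm.prod_one_add_le (fun D => nrm I D) (fun K => nrm_one_le I K)
    (nrm_zero_right I) (norm_nonneg y) (uuBound_nonneg D y) (fun K => nrm_tt_mul_le I K y) D
    (fun K hK j => (nrm_cc_mul_le _ _ _ _).trans ?_) m
  have h0 := uuBound_nonneg K y
  have h2 : uuBound K y ≤ uuBound D y := uuBound_mono y hK
  rw [norm_mul, norm_neg, norm_div, norm_one, Complex.norm_natCast, norm_natCast_add_one]
  calc _ ≤ (k : ℝ) * (1 / ((j : ℝ) + 1)) * (uuBound K y / (((k + j : ℕ) : ℝ) + 1)) :=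
        mul_le_mul_of_nonneg_left (nrm_uu_le _ _ _ _) (by positivity)
    _ = uuBound K y / ((j : ℝ) + 1) * ((k : ℝ) / (((k + j : ℕ) : ℝ) + 1)) := by ring
    _ ≤ uuBound K y / ((j : ℝ) + 1) * 1 := by
        refine mul_le_mul_of_nonneg_left ?_ (by positivity)
        rw [div_le_one (by positivity)]
        push_cast
        linarith [j.cast_nonneg (α := ℝ)]
    _ ≤ _ := by rw [mul_one]; gcongr

theorem grow_conn (y : ℂ) (k : ℕ) : Grow 1 (fun m => conn y m (k + 1)) := fun I D =>
  ⟨(1 + ‖y‖ * uuBound D y) ^ D, D, by have := uuBound_nonneg D y; positivity, fun m => by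
    have h1 := uuBound_nonneg D y
    have h2 := har_pos m
    calc _ ≤ _ := nrm_conn_le I D y m (k + 1)
      _ ≤ 1 / ((m : ℝ) + 1) * ((1 + ‖y‖ * uuBound D y) * har m) ^ D :=
          mul_le_mul_of_nonneg_right (invChoose_succ_right_le m k) (by positivity)
      _ = _ := by rw [mul_pow, pow_one]; ring⟩

/-- The terms of the connected sum. -/
noncomputable def connTerm (y s : ℂ) (k m : ℕ) : Ser :=
  uu 0 m * uu y m * QQ y s m * conn y (m + 1) k

/-- The bound separates the variables: summable in m, and tending to 0 in k through a common factor.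
Hence the connected sum vanishes as k → ∞. -/
theorem nrm_connTerm_le (y s : ℂ) (I D : ℕ) : ∃ (C : ℝ) (p : ℕ), 0 ≤ C ∧ ∀ k m,
    nrm I D (connTerm y s k m) ≤ 1 / ((k : ℝ) + 1) * (C * (har m ^ p / ((m : ℝ) + 1) ^ 2)) := by
  obtain ⟨C, p, h0, h⟩ := (((grow_uu 0).mul (grow_uu y)).mul (grow_QQ y s)) I D
  have hB := uuBound_nonneg D y
  set B := 1 + ‖y‖ * uuBound D y with hBd
  have hB0 : 0 ≤ B := by positivity
  refine ⟨C * (2 * B) ^ D, p + D, by positivity, fun k m => (map_mul_le_mul _ _ _).trans ?_⟩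
  have h1 := har_pos m
  have h3 : har (m + 1) ≤ 2 * har m := har_succ_le m
  have h2 : nrm I D (conn y (m + 1) k) ≤ 1 / ((k : ℝ) + 1) * (B * (2 * har m)) ^ D := by
    refine (nrm_conn_le I D y (m + 1) k).trans ?_
    have := har_pos (m + 1)
    exact mul_le_mul (invChoose_succ_le m k) (by gcongr) (by positivity) (by positivity)
  calc _ ≤ C * (har m ^ p / ((m : ℝ) + 1) ^ (1 + 1 + 0)) * (1 / ((k : ℝ) + 1) * (B * (2 * har m)) ^ D) :=
        mul_le_mul (h m) h2 (apply_nonneg _ _) (by positivity)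
    _ = _ := by rw [mul_pow, mul_pow, mul_pow, pow_add]; ring

theorem grow_connTerm (y s : ℂ) (k : ℕ) : Grow 2 (connTerm y s k) := fun I D => by
  obtain ⟨C, p, h0, h⟩ := nrm_connTerm_le y s I D
  exact ⟨1 / ((k : ℝ) + 1) * C, p, by positivity, fun m => (h k m).trans_eq (by ring)⟩

theorem conv_serSum_connTerm (y s : ℂ) : Conv (fun k => serSum (connTerm y s k)) 0 := by
  intro i d
  obtain ⟨C, p, h0, h⟩ := nrm_connTerm_le y s (i + 1) (d + 1)
  rw [map_zero]
  have hs := (summable_har_pow_div_sq p).mul_left C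
  refine squeeze_zero_norm (a := fun k : ℕ => 1 / ((k : ℝ) + 1) *
    ∑' m : ℕ, C * (har m ^ p / ((m : ℝ) + 1) ^ 2)) (fun k => ?_) ?_
  · rw [co_serSum, ← tsum_mul_left]
    exact tsum_of_norm_bounded (hs.mul_left _).hasSum
      fun m => (norm_co_le i d _).trans (h k m)
  · have := (tendsto_one_div_add_atTop_nhds_zero_nat (𝕜 := ℝ)).mul_const
      (∑' m : ℕ, C * (har m ^ p / ((m : ℝ) + 1) ^ 2))
    rwa [zero_mul] at this

/-- Summing the telescoping relation over m leaves the boundary value at m = 0; the one at m = N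
tends to 0 because the connector is O(1/N) up to logarithms. -/
theorem serSum_connTerm_sub (y s : ℂ) (k : ℕ) :
    serSum (connTerm y s k) - serSum (connTerm y s (k + 1)) = uu y k * iz s k := by
  have h1 := (grow_connTerm y s k).conv_serSum.sub (grow_connTerm y s (k + 1)).conv_serSum
  have h2 : Conv (fun N => QQ y s N * conn y N (k + 1) * (uu y k * iz s k)) (0 * (uu y k * iz s k)) :=
    Conv.mul (by simpa using ((grow_QQ y s).mul (grow_conn y k)).conv_zero) (conv_const _)
  have h3 := (conv_const (uu y k * iz s k)).sub h2
  rw [zero_mul, sub_zero] at h3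
  refine h1.unique (h3.congr fun N => ?_)
  rw [← Finset.sum_sub_distrib]
  have e := Finset.sum_range_sub' (fun m => QQ y s m * conn y m (k + 1) * (uu y k * iz s k)) N
  simp only [connTerm]
  rw [Finset.sum_congr rfl fun m _ => conn_telescope y s m k, e]
  simp [QQ_zero, conn]

/-- The sum formula. -/
theorem conv_genSum_self (y s : ℂ) :
    Conv (fun K => ∑ k ∈ Finset.range K, tt y * (uu y k * iz s k)) (genSum y y s) := by
  -- At k = 0 the connector is 1, so the connected sum starts at `genSum y y s` divided by yt.
  have e : genSum y y s = tt y * serSum (connTerm y s 0) := by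
    refine (grow_term y y s).conv_serSum.unique
      (((conv_const (tt y)).mul (grow_connTerm y s 0).conv_serSum).congr fun N => ?_)
    rw [Finset.mul_sum]
    refine Finset.sum_congr rfl fun m _ => ?_
    rw [connTerm, conn_zero_right, uu_sub_uu_zero]
    ring
  have h := (conv_const (tt y)).mul
    ((conv_const (serSum (connTerm y s 0))).sub (conv_serSum_connTerm y s))
  rw [sub_zero, ← e] at h
  refine h.congr fun K => ?_
  rw [← Finset.mul_sum, ← Finset.sum_range_sub' (fun k => serSum (connTerm y s k)) K]
  simp only [serSum_connTerm_sub]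

theorem hasSum_riemannZeta_succ {k : ℕ} (hk : 1 < k) :
    HasSum (fun n : ℕ => 1 / ((n : ℂ) + 1) ^ k) (riemannZeta k) := by
  rw [zeta_nat_eq_tsum_of_gt_one hk]
  have hs : Summable fun n : ℕ => 1 / (n : ℂ) ^ k := by
    simpa only [Complex.cpow_natCast] using (Complex.summable_one_div_nat_cpow (p := (k : ℂ))).mpr
      (by simp only [Complex.natCast_re]; exact_mod_cast hk)
  have h3 := (hasSum_nat_add_iff' 1).mpr hs.hasSum
  have hk0 : k ≠ 0 := by omega
  simpa [hk0] using h3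

/-- Expand the two geometric series in t and z. The restriction on `d` is genuine: the factor yt
makes the coefficient zero for d = 0. -/
theorem coeff_genSum_self (y s : ℂ) (i d : ℕ) (hd : d ≠ 0) :
    co i d (genSum y y s) = s ^ i * y ^ d * riemannZeta ((d + i + 1 : ℕ) : ℂ) := by
  obtain ⟨d, rfl⟩ := Nat.exists_eq_succ_of_ne_zero hd
  have h := conv_genSum_self y s i (d + 1)
  have e : ∀ k, co i (d + 1) (tt y * (uu y k * iz s k)) =
      s ^ i * y ^ (d + 1) * (1 / ((k : ℂ) + 1) ^ (d + 1 + i + 1)) := by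
    intro k
    rw [← mul_assoc, uu, tt, ← map_mul, co_apply, iz, PowerSeries.coeff_C_mul, PowerSeries.coeff_mk,
      PowerSeries.coeff_mul_C, mul_assoc, PowerSeries.coeff_C_mul, PowerSeries.coeff_succ_X_mul,
      PowerSeries.coeff_mk, show d + 1 + i + 1 = (d + 1) + (i + 1) by ring, pow_add _ (d + 1) (i + 1)]
    field_simp
    ring
  simp only [map_sum, e] at h
  exact tendsto_nhds_unique h
    ((hasSum_riemannZeta_succ (k := d + 1 + i + 1) (by omega)).mul_left _).tendsto_sum_nat

/-! ### The product formula -/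

/-- The differences `QQ y s n - QQ y s (n - 1)`. -/
noncomputable def gg (y s : ℂ) : ℕ → Ser
  | 0 => 1
  | n + 1 => zz s * (uu y n * QQ y s n)

theorem sum_gg (y s : ℂ) (N : ℕ) : ∑ n ∈ Finset.range (N + 1), gg y s n = QQ y s N := by
  induction N with
  | zero => simp [gg, QQ_zero]
  | succ N ih => rw [Finset.sum_range_succ, ih, QQ_succ, gg]; ring

theorem grow_gg (y s : ℂ) : Grow 1 (gg y s) :=
  Grow.of_succ (((grow_uu y).mul (grow_QQ y s)).const_mul (zz s))

open PowerSeries in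
theorem mk_gg (y s : ℂ) : mk (gg y s) = (1 - X) * mk (QQ y s) := by
  rw [one_sub_X_mul_mk_QQ]
  ext n : 1
  cases n with
  | zero => simp [gg]
  | succ n => simp [gg, coeff_one, coeff_succ_X_mul]

theorem sum_antidiagonal_bb_mul_gg (y s : ℂ) (m : ℕ) :
    ∑ p ∈ antidiagonal m, bb y s p.1 * gg 0 s p.2 = gg y s m := by
  have h : PowerSeries.mk (bb y s) * PowerSeries.mk (gg 0 s) = PowerSeries.mk (gg y s) := by
    rw [mk_gg, mk_gg, mk_QQ_eq y s]; ring
  simpa [PowerSeries.coeff_mul] using congrArg (PowerSeries.coeff m) h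

theorem Grow.succ {a : ℕ} {f : ℕ → Ser} (hf : Grow a f) : Grow a (fun n => f (n + 1)) := by
  intro I D
  obtain ⟨C, k, h0, h⟩ := hf I D
  refine ⟨C * 2 ^ k, k, by positivity, fun n => (h (n + 1)).trans ?_⟩
  have h1 := har_pos n
  have h2 := har_pos (n + 1)
  have h3 : har (n + 1) ≤ 2 * har n := har_succ_le n
  calc _ ≤ C * ((2 * har n) ^ k / ((n : ℝ) + 1) ^ a) := by
        gcongr
        linarith
    _ = _ := by rw [mul_pow]; ring

/-- Convolving `bb y s` with the increments of `QQ 0 s` gives the increments of `QQ y s`. Thus `QQ y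
s N` is the triangular partial sum of a product of series whose square partial sum is the other
term. -/
theorem grow_bb_mul_QQ_sub (y s : ℂ) : Grow 1 (fun N =>
    (∑ n ∈ Finset.range (N + 1), bb y s n) * QQ 0 s N - QQ y s N) := by
  have h := ((grow_bb y s).sum_mul_sum_sub (grow_gg 0 s)).succ
  simpa only [sum_antidiagonal_bb_mul_gg, sum_gg] using h

/-- The product of the sums of the series `bb`. -/
noncomputable def beta (x y : ℂ) : Ser := serSum (bb y 1) * serSum (bb x (-1))

/-- The limit of the products of `1 - z ^ 2 / j ^ 2`. -/
theorem exists_conv_QQ_zero : ∃ T : Ser, T ≠ 0 ∧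
    Conv (fun N => QQ 0 1 N * QQ 0 (-1) N) T := by
  set f : ℕ → Ser := fun N => QQ 0 1 N * QQ 0 (-1) N with hf
  have hg : Grow 2 (fun n => f (n + 1) - f n) := by
    have h := ((((grow_uu 0).mul (grow_uu 0)).mul ((grow_QQ 0 1).mul (grow_QQ 0 (-1)))).const_mul
      (-(zz 1 * zz 1)))
    convert h using 2 with n
    simp only [hf, QQ_succ, zz_neg]
    ring
  have hc : Conv f (serSum (fun n => f (n + 1) - f n) + 1) :=
    (hg.conv_serSum.add (conv_const 1)).congr fun N => by
      rw [Finset.sum_range_sub]; simp [hf, QQ_zero]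
  refine ⟨_, fun h0 => ?_, hc⟩
  rw [h0] at hc
  have h1 : ∀ N, co 0 0 (f N) = 1 := fun N => by
    simp [co_apply, hf, QQ, zz, map_prod]
  have h2 := hc 0 0
  simp only [h1, map_zero] at h2
  exact one_ne_zero (tendsto_nhds_unique tendsto_const_nhds h2)

/-- This replaces Gauss's evaluation at 1. The factors `QQ` may grow logarithmically, but the errors
are O(1/N) up to logarithms and absorb that growth, while the two products with parameter 0 combine
into a convergent one. -/
theorem conv_QQ_mul_QQ (x y : ℂ) {T : Ser} (hT : Conv (fun N => QQ 0 1 N * QQ 0 (-1) N) T) :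
    Conv (fun N => QQ y 1 N * QQ x (-1) N) (beta x y * T) := by
  have hB : ∀ y s, Grow 0 (fun N => ∑ n ∈ Finset.range (N + 1), bb y s n) :=
    fun y s => ((grow_bb y s).anti one_le_two).sum.succ
  have e1 := (grow_bb_mul_QQ_sub y 1).mul ((hB x (-1)).mul (grow_QQ 0 (-1)))
  have e2 := (grow_QQ y 1).mul (grow_bb_mul_QQ_sub x (-1))
  have e3 := (e1.add (e2.anti (by norm_num))).conv_zero
  have e4 := (((grow_bb y 1).conv_serSum.comp_succ.mul (grow_bb x (-1)).conv_serSum.comp_succ).mul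
    hT).sub e3
  rw [sub_zero] at e4
  exact e4.congr fun N => by ring

/-- The derivative of `f` in `z`. -/
noncomputable abbrev dz (f : Ser) : Ser := PowerSeries.derivative (PowerSeries ℂ) f

theorem Conv.dz {f : ℕ → Ser} {a : Ser} (h : Conv f a) : Conv (fun n => dz (f n)) (dz a) := by
  intro i d
  have e : ∀ g : Ser, co i d (_root_.dz g) = co (i + 1) d g * ((i : ℂ) + 1) := fun g => by
    have : ((i : PowerSeries ℂ) + 1) = PowerSeries.C ((i : ℂ) + 1) := by simp
    rw [co_apply, PowerSeries.coeff_derivative, this, PowerSeries.coeff_mul_C, co_apply]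
  simp only [e]
  exact (h (i + 1) d).mul_const _

/-- The inverse of `n + 1 - y * t` in `ℂ⟦t⟧`. -/
noncomputable def uc (y : ℂ) (n : ℕ) : PowerSeries ℂ :=
  PowerSeries.mk fun d => y ^ d / ((n : ℂ) + 1) ^ (d + 1)

theorem coeff_uc_pow (y : ℂ) (n i d : ℕ) : PowerSeries.coeff d (uc y n ^ (i + 1)) =
    ((d + i).choose i : ℂ) * (y ^ d / ((n : ℂ) + 1) ^ (d + i + 1)) := by
  have hn : ((n : ℂ) + 1) ≠ 0 := by exact_mod_cast n.succ_ne_zero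
  have e : uc y n = PowerSeries.C (1 / ((n : ℂ) + 1)) *
      PowerSeries.rescale (y / ((n : ℂ) + 1)) (PowerSeries.mk 1) := by
    ext d
    rw [uc, PowerSeries.coeff_C_mul, PowerSeries.coeff_rescale, PowerSeries.coeff_mk,
      PowerSeries.coeff_mk, Pi.one_apply, div_pow]
    field_simp
    ring
  rw [e, mul_pow, ← map_pow, ← map_pow, PowerSeries.mk_one_pow_eq_mk_choose_add,
    PowerSeries.coeff_C_mul, PowerSeries.coeff_rescale, PowerSeries.coeff_mk, div_pow, div_pow,
    one_pow, add_comm i d, show d + i + 1 = (i + 1) + d by ring, pow_add _ (i + 1) d]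
  field_simp

/-- The logarithmic derivative of `1 + s * z / (j + 1 - y * t)` in `z`. -/
noncomputable def lam (y s : ℂ) (j : ℕ) : Ser :=
  PowerSeries.mk fun i => (-1) ^ i * (PowerSeries.C s * uc y j) ^ (i + 1)

theorem PowerSeries.one_add_X_mul_log_derivative {R : Type*} [CommRing R] (a : R) :
    (1 + C a * X) * (mk fun i => (-1) ^ i * a ^ (i + 1)) = C a := by
  ext i
  rw [add_mul, one_mul, mul_assoc, map_add, coeff_C_mul, coeff_mk, coeff_C]
  cases i with
  | zero => simp
  | succ i => rw [coeff_succ_X_mul, coeff_mk, if_neg (Nat.succ_ne_zero i)]; ring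

theorem dz_QQ (y s : ℂ) (N : ℕ) :
    dz (QQ y s N) = QQ y s N * ∑ j ∈ Finset.range N, lam y s j := by
  induction N with
  | zero => simp [QQ_zero, dz]
  | succ N ih =>
    have e : zz s * uu y N = PowerSeries.C (PowerSeries.C s * uc y N) * PowerSeries.X := by
      rw [map_mul]; simp only [zz, uu, uc]; ring
    have h := PowerSeries.one_add_X_mul_log_derivative (PowerSeries.C s * uc y N)
    have hd : PowerSeries.derivative (PowerSeries ℂ)
        (PowerSeries.C (PowerSeries.C s * uc y N) * PowerSeries.X) =
        PowerSeries.C (PowerSeries.C s * uc y N) := by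
      rw [PowerSeries.derivative_mul, PowerSeries.derivative_C, PowerSeries.derivative_X]
      ring
    rw [QQ_succ, Finset.sum_range_succ, dz, PowerSeries.derivative_mul]
    change _ * dz _ + _ * dz _ = _
    rw [ih, e, dz, map_add, PowerSeries.derivative_one, hd, lam]
    linear_combination (-QQ y s N) * h

/-- The part constant in t, which contains the divergent harmonic sum, cancels in the difference;
all remaining exponents d+i+1 are at least 2. -/
theorem co_lam_sub (y s : ℂ) (j i d : ℕ) : co i d (lam y s j - lam 0 s j) =
    if d = 0 then 0 else (-1) ^ i * s ^ (i + 1) * ((d + i).choose i : ℂ) * y ^ d *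
      (1 / ((j : ℂ) + 1) ^ (d + i + 1)) := by
  have h : ∀ y, co i d (lam y s j) = (-1) ^ i * s ^ (i + 1) * (((d + i).choose i : ℂ) *
      (y ^ d / ((j : ℂ) + 1) ^ (d + i + 1))) := fun y => by
    have : ((-1 : PowerSeries ℂ) ^ i * (PowerSeries.C s * uc y j) ^ (i + 1)) =
        PowerSeries.C ((-1) ^ i * s ^ (i + 1)) * uc y j ^ (i + 1) := by
      simp only [map_mul, map_pow, map_neg, map_one]; ring
    rw [co_apply, lam, PowerSeries.coeff_mk, this, PowerSeries.coeff_C_mul, coeff_uc_pow]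
  rw [map_sub, h, h]
  split_ifs with hd
  · simp [hd]
  · rw [zero_pow hd]; ring

/-- The coefficients in `z` of the logarithmic derivative of `beta x y`. -/
noncomputable def pw (x y : ℂ) (i : ℕ) : PowerSeries ℂ :=
  PowerSeries.mk fun d => if d = 0 then 0 else
    ((d + i).choose i : ℂ) * ((-1) ^ i * y ^ d - x ^ d) * riemannZeta ((d + i + 1 : ℕ) : ℂ)

theorem conv_lam (x y : ℂ) : Conv (fun N => ∑ j ∈ Finset.range N,
    ((lam y 1 j - lam 0 1 j) + (lam x (-1) j - lam 0 (-1) j))) (PowerSeries.mk (pw x y)) := by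
  intro i d
  simp only [map_sum, map_add, co_lam_sub, co_apply i d (PowerSeries.mk _), PowerSeries.coeff_mk, pw]
  split_ifs with hd
  · simp
  · have h := hasSum_riemannZeta_succ (k := d + i + 1) (by omega)
    have h1 := h.mul_left (((d + i).choose i : ℂ) * ((-1) ^ i * y ^ d - x ^ d))
    convert h1.tendsto_sum_nat using 2 with N
    refine Finset.sum_congr rfl fun j _ => ?_
    have e : (-1 : ℂ) ^ i * (-1) ^ (i + 1) = -1 := by
      rw [pow_succ, ← mul_assoc, ← mul_pow]; simp
    rw [one_pow]
    linear_combination ((d + i).choose i : ℂ) * x ^ d * (1 / ((j : ℂ) + 1) ^ (d + i + 1)) * e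

/-- With P_N and T_N the finite products converging to βT and T, the Wronskian T_N P_N′ − P_N T_N′
equals T_N P_N times the difference of the logarithmic derivatives. Its limit is T²β′ on one side
and T²β times the zeta series on the other. -/
theorem dz_beta (x y : ℂ) : dz (beta x y) = beta x y * PowerSeries.mk (pw x y) := by
  obtain ⟨T, hT0, hT⟩ := exists_conv_QQ_zero
  have hP := conv_QQ_mul_QQ x y hT
  have h1 := (hT.mul hP.dz).sub (hP.mul hT.dz)
  have h2 := (hT.mul hP).mul (conv_lam x y)
  have h3 := h1.unique (h2.congr fun N => by
    simp only [dz, PowerSeries.derivative_mul]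
    simp only [dz_QQ, Finset.sum_add_distrib, Finset.sum_sub_distrib]
    ring)
  simp only [dz, PowerSeries.derivative_mul] at h3 ⊢
  -- The limit T is cancelled without being evaluated: only T ≠ 0 is needed.
  refine mul_left_cancel₀ (mul_ne_zero hT0 hT0) ?_
  linear_combination h3

theorem coeff_zero_beta (x y : ℂ) : PowerSeries.coeff 0 (beta x y) = 1 := by
  have h : ∀ y s, PowerSeries.coeff 0 (serSum (bb y s)) = 1 := fun y s => by
    ext d
    have e := co_serSum (bb y s) 0 d
    rw [co_apply] at e
    rw [e, tsum_eq_single 0]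
    · simp [bb, co_apply]
    · intro n hn
      obtain ⟨n, rfl⟩ := Nat.exists_eq_succ_of_ne_zero hn
      simp [bb, co_apply, zz]
  rw [beta, PowerSeries.coeff_mul]
  simp [h]

/-- Newton's recursion, with `pw` in the role of signed power sums. -/
theorem succ_mul_coeff_beta (x y : ℂ) (i : ℕ) :
    PowerSeries.coeff (i + 1) (beta x y) * ((i : PowerSeries ℂ) + 1) =
      ∑ p ∈ antidiagonal i, PowerSeries.coeff p.1 (beta x y) * pw x y p.2 := by
  have h := congrArg (PowerSeries.coeff i) (dz_beta x y)
  rwa [PowerSeries.coeff_derivative, PowerSeries.coeff_mul, Finset.sum_congr rfl fun p _ => by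
    rw [PowerSeries.coeff_mk]] at h

/-! ### Multiple zeta values as limits of iterated sums -/

theorem sum_antidiagonalTuple_succ {M : Type*} [AddCommMonoid M] (n d : ℕ)
    (f : (Fin (n + 1) → ℕ) → M) :
    ∑ e ∈ Finset.Nat.antidiagonalTuple (n + 1) d, f e =
      ∑ p ∈ antidiagonal d, ∑ e ∈ Finset.Nat.antidiagonalTuple n p.2, f (Fin.cons p.1 e) := by
  rw [Finset.sum_sigma']
  refine Finset.sum_bij' (fun e _ => ⟨(e 0, ∑ i, Fin.tail e i), Fin.tail e⟩)
    (fun q _ => Fin.cons q.1.1 q.2) ?_ ?_ ?_ ?_ ?_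
  · intro e he
    rw [Finset.Nat.mem_antidiagonalTuple, Fin.sum_univ_succ] at he
    simp [Finset.Nat.mem_antidiagonalTuple, Fin.tail, he]
  · rintro ⟨⟨a, b⟩, e⟩ h
    simp only [Finset.mem_sigma, Finset.HasAntidiagonal.mem_antidiagonal,
      Finset.Nat.mem_antidiagonalTuple] at h
    simp [Finset.Nat.mem_antidiagonalTuple, Fin.sum_univ_succ, h.1, h.2]
  · intro e _
    simp
  · rintro ⟨⟨a, b⟩, e⟩ h
    simp only [Finset.mem_sigma, Finset.HasAntidiagonal.mem_antidiagonal,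
      Finset.Nat.mem_antidiagonalTuple] at h
    simp [h.2]
  · intro e _
    simp

theorem sum_tuples {M : Type*} [AddCommMonoid M] {n : ℕ} (D : ℕ) (b c : Fin n → ℕ)
    (hcb : ∀ i, c i ≤ b i) (f : (Fin n → ℕ) → M) :
    ∑ j ∈ tuples (D + ∑ i, c i) b, f j = ∑ e ∈ Finset.Nat.antidiagonalTuple n D,
      if ∀ i, b i ≤ e i + c i then f (fun i => e i + c i) else 0 := by
  rw [← Finset.sum_filter]
  refine Finset.sum_bij' (fun j _ i => j i - c i) (fun e _ i => e i + c i) ?_ ?_ ?_ ?_ ?_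
  · intro j hj
    obtain ⟨h1, h2⟩ := mem_tuples.mp hj
    have h3 : ∀ i, j i - c i + c i = j i := fun i => Nat.sub_add_cancel ((hcb i).trans (h2 i))
    have h4 : ∑ i, (j i - c i) + ∑ i, c i = ∑ i, j i := by
      rw [← Finset.sum_add_distrib]
      exact Finset.sum_congr rfl fun i _ => h3 i
    rw [Finset.mem_filter, Finset.Nat.mem_antidiagonalTuple]
    exact ⟨by omega, fun i => (h2 i).trans_eq (h3 i).symm⟩
  · intro e he
    rw [Finset.mem_filter, Finset.Nat.mem_antidiagonalTuple] at he
    exact mem_tuples.mpr ⟨by rw [Finset.sum_add_distrib, he.1], he.2⟩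
  · intro j hj
    funext i
    exact Nat.sub_add_cancel ((hcb i).trans ((mem_tuples.mp hj).2 i))
  · intro e _
    funext i
    exact Nat.add_sub_cancel _ _
  · intro j hj
    congr 1
    funext i
    exact (Nat.sub_add_cancel ((hcb i).trans ((mem_tuples.mp hj).2 i))).symm

/-- The strictly decreasing tuples with entries between `1` and `N`. -/
def chains (n N : ℕ) : Finset (Fin n → ℕ) :=
  (Fintype.piFinset fun _ => Finset.Icc 1 N).filter StrictAnti

theorem mem_chains {n N : ℕ} {m : Fin n → ℕ} :
    m ∈ chains n N ↔ (∀ i, 1 ≤ m i ∧ m i ≤ N) ∧ StrictAnti m := by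
  simp [chains]

theorem strictAnti_cons_iff {n a : ℕ} {m : Fin n → ℕ} :
    StrictAnti (Fin.cons a m : Fin (n + 1) → ℕ) ↔ (∀ i, m i < a) ∧ StrictAnti m := by
  constructor
  · intro h
    exact ⟨fun i => by simpa using h (Fin.succ_pos i),
      fun i j hij => by simpa using h (Fin.succ_lt_succ_iff.mpr hij)⟩
  · rintro ⟨h1, h2⟩ i j hij
    cases j using Fin.cases with
    | zero => exact absurd hij (Fin.not_lt_zero i)
    | succ j =>
      cases i using Fin.cases with
      | zero => simpa using h1 j
      | succ i => simpa using h2 (Fin.succ_lt_succ_iff.mp hij)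

theorem sum_chains_succ {M : Type*} [AddCommMonoid M] (n N : ℕ) (f : (Fin (n + 1) → ℕ) → M) :
    ∑ m ∈ chains (n + 1) N, f m =
      ∑ a ∈ Finset.range N, ∑ m ∈ chains n a, f (Fin.cons (a + 1) m) := by
  rw [Finset.sum_sigma']
  refine Finset.sum_bij' (fun m _ => ⟨m 0 - 1, Fin.tail m⟩) (fun q _ => Fin.cons (q.1 + 1) q.2)
    ?_ ?_ ?_ ?_ ?_
  · intro m hm
    obtain ⟨h1, h2⟩ := mem_chains.mp hm
    rw [← Fin.cons_self_tail m, strictAnti_cons_iff] at h2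
    have h0 := h1 0
    simp only [Finset.mem_sigma, Finset.mem_range, mem_chains]
    refine ⟨by omega, fun i => ⟨(h1 i.succ).1, ?_⟩, h2.2⟩
    have := h2.1 i
    omega
  · rintro ⟨a, m⟩ h
    simp only [Finset.mem_sigma, Finset.mem_range, mem_chains] at h
    obtain ⟨ha, h1, h2⟩ := h
    rw [mem_chains, strictAnti_cons_iff]
    refine ⟨fun i => ?_, fun i => Nat.lt_succ_of_le (h1 i).2, h2⟩
    cases i using Fin.cases with
    | zero => simp; omega
    | succ i => simpa using ⟨(h1 i).1, (h1 i).2.trans ha.le⟩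
  · intro m hm
    have h0 := (mem_chains.mp hm).1 0
    rw [Nat.sub_add_cancel h0.1, Fin.cons_self_tail]
  · rintro ⟨a, m⟩ _
    simp
  · intro m hm
    have h0 := (mem_chains.mp hm).1 0
    rw [Nat.sub_add_cancel h0.1, Fin.cons_self_tail]

/-- The truncated multiple zeta values. -/
noncomputable def mzvTrunc {n : ℕ} (k : Fin n → ℕ) (N : ℕ) : ℝ :=
  ∑ m ∈ chains n N, ∏ i, 1 / (m i : ℝ) ^ k i

theorem mzvTrunc_cons {n : ℕ} (a : ℕ) (k : Fin n → ℕ) (N : ℕ) :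
    mzvTrunc (Fin.cons a k : Fin (n + 1) → ℕ) N =
      ∑ j ∈ Finset.range N, 1 / ((j : ℝ) + 1) ^ a * mzvTrunc k j := by
  rw [mzvTrunc, sum_chains_succ]
  refine Finset.sum_congr rfl fun j _ => ?_
  rw [mzvTrunc, Finset.mul_sum]
  refine Finset.sum_congr rfl fun m _ => ?_
  simp [Fin.prod_univ_succ, mul_comm]

theorem tendsto_mzvTrunc {n : ℕ} [NeZero n] (k : Fin n → ℕ) (h0 : 2 ≤ k 0) (h : ∀ i, 1 ≤ k i) :
    Filter.Tendsto (mzvTrunc k) Filter.atTop (nhds (mzv k)) := by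
  classical
  have hs := (summable_mzv k h0 h).hasSum
  have ht : Filter.Tendsto (fun N => (chains n N).subtype fun m => StrictAnti m ∧ ∀ i, 0 < m i)
      Filter.atTop Filter.atTop := by
    refine Filter.tendsto_atTop_finset_of_monotone (fun N N' hN m hm => ?_) fun m => ?_
    · rw [Finset.mem_subtype, mem_chains] at hm ⊢
      exact ⟨fun i => ⟨(hm.1 i).1, (hm.1 i).2.trans hN⟩, hm.2⟩
    -- Each entry of a tuple of natural numbers is at most their sum, so this truncation level
    -- contains the tuple.
    · refine ⟨∑ i, m.1 i, Finset.mem_subtype.mpr (mem_chains.mpr ⟨fun i => ⟨m.2.2 i, ?_⟩, m.2.1⟩)⟩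
      exact Finset.single_le_sum (f := m.1) (fun i _ => Nat.zero_le _) (Finset.mem_univ i)
  refine (hs.comp ht).congr fun N => ?_
  rw [Function.comp_apply, mzvTrunc]
  refine (Finset.sum_subtype_eq_sum_filter (s := chains n N)
    (fun m : Fin n → ℕ => ∏ i, 1 / (m i : ℝ) ^ k i)).trans ?_
  rw [Finset.filter_true_of_mem]
  intro m hm
  exact ⟨(mem_chains.mp hm).2, fun i => ((mem_chains.mp hm).1 i).1⟩

theorem co_uu_mul (y : ℂ) (n i d : ℕ) (f : Ser) : co i d (uu y n * f) =
    ∑ p ∈ antidiagonal d, y ^ p.1 / ((n : ℂ) + 1) ^ (p.1 + 1) * co i p.2 f := by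
  rw [uu, co_apply, PowerSeries.coeff_C_mul, PowerSeries.coeff_mul]
  simp [co_apply]

theorem co_zz_mul (s : ℂ) (i d : ℕ) (f : Ser) : co (i + 1) d (zz s * f) = s * co i d f := by
  rw [zz, mul_assoc, co_apply, PowerSeries.coeff_C_mul, PowerSeries.coeff_C_mul,
    PowerSeries.coeff_succ_X_mul, co_apply]

theorem QQ_eq_sum (y s : ℂ) (N : ℕ) :
    QQ y s N = 1 + zz s * ∑ j ∈ Finset.range N, uu y j * QQ y s j := by
  induction N with
  | zero => simp [QQ_zero]
  | succ N ih =>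
    rw [QQ_succ, Finset.sum_range_succ]
    linear_combination ih

/-- Choosing the term in z from i of the factors of the product selects a chain of i indices;
expanding each 1/(j−yt) in t produces all exponents at least 1 of the prescribed total weight. -/
theorem co_QQ (y s : ℂ) (i d N : ℕ) : co i d (QQ y s N) =
    s ^ i * y ^ d * ∑ e ∈ Finset.Nat.antidiagonalTuple i d, (mzvTrunc (fun j => e j + 1) N : ℂ) := by
  induction i generalizing d N with
  | zero =>
    have h0 : co 0 d (QQ y s N) = co 0 d 1 := by
      simp [co_apply, QQ, zz, map_prod]
    have h1 : ∀ k : Fin 0 → ℕ, mzvTrunc k N = 1 := fun k => by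
      have : chains 0 N = Finset.univ := by
        ext m
        exact iff_of_true (mem_chains.mpr ⟨fun i => i.elim0, fun i => i.elim0⟩) (Finset.mem_univ _)
      simp [mzvTrunc, this]
    rw [h0]
    cases d with
    | zero => simp [co_apply, h1]
    | succ d => simp [co_apply, PowerSeries.coeff_one]
  | succ i ih =>
    have h1 : co (i + 1) d 1 = 0 := by simp [co_apply, PowerSeries.coeff_one]
    rw [QQ_eq_sum, map_add, h1, zero_add, co_zz_mul, map_sum, sum_antidiagonalTuple_succ]
    simp only [co_uu_mul, ih]
    rw [Finset.sum_comm, Finset.mul_sum, Finset.mul_sum]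
    refine Finset.sum_congr rfl fun p hp => ?_
    have hp' : p.1 + p.2 = d := Finset.HasAntidiagonal.mem_antidiagonal.mp hp
    have h2 : ∀ e : Fin i → ℕ, (fun j => (Fin.cons p.1 e : Fin (i + 1) → ℕ) j + 1) =
        Fin.cons (p.1 + 1) (fun j => e j + 1) := fun e => by
      funext j
      cases j using Fin.cases <;> simp
    simp only [h2, mzvTrunc_cons, Complex.ofReal_sum]
    rw [Finset.sum_comm, Finset.mul_sum, Finset.mul_sum]
    refine Finset.sum_congr rfl fun j _ => ?_
    push_cast
    rw [← Finset.mul_sum, ← hp', pow_add y p.1 p.2]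
    ring

theorem co_uu_sub_mul (w : ℂ) (m i d : ℕ) (f : Ser) : co i d ((uu w m - uu 0 m) * f) =
    ∑ p ∈ antidiagonal d, if 1 ≤ p.1 then w ^ p.1 * (1 / ((m : ℂ) + 1) ^ (p.1 + 1)) * co i p.2 f
      else 0 := by
  rw [sub_mul, map_sub, co_uu_mul, co_uu_mul, ← Finset.sum_sub_distrib]
  refine Finset.sum_congr rfl fun p _ => ?_
  split_ifs with h
  · rw [zero_pow (by omega)]; ring
  · have : p.1 = 0 := by omega
    simp [this]

theorem weightedSum_eq (i D : ℕ) (x y : ℂ) : weightedSum (D + (i + 1)) (i + 1) x y =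
    ∑ p ∈ antidiagonal D, if 1 ≤ p.1 then x ^ p.1 * y ^ p.2 *
      ∑ e ∈ Finset.Nat.antidiagonalTuple i p.2,
        (mzv (Fin.cons (p.1 + 1) (fun j => e j + 1) : Fin (i + 1) → ℕ) : ℂ) else 0 := by
  have h := sum_tuples D (fun j : Fin (i + 1) => if j = 0 then 2 else 1) (fun _ => 1)
    (fun j => by split_ifs <;> norm_num)
    (fun k => x ^ (k 0 - 1) * y ^ (D + (i + 1) - k 0 - (i + 1 - 1)) * (mzv k : ℂ))
  rw [Finset.sum_const, Finset.card_univ, Fintype.card_fin, smul_eq_mul, mul_one] at h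
  rw [weightedSum]
  refine h.trans ?_
  rw [sum_antidiagonalTuple_succ]
  refine Finset.sum_congr rfl fun p hp => ?_
  have hp' : p.1 + p.2 = D := Finset.HasAntidiagonal.mem_antidiagonal.mp hp
  have hc : ∀ e : Fin i → ℕ, (∀ j, (if j = 0 then 2 else 1) ≤
      (Fin.cons p.1 e : Fin (i + 1) → ℕ) j + 1) ↔ 1 ≤ p.1 := fun e => by
    rw [Fin.forall_fin_succ]
    simp
  have h2 : ∀ e : Fin i → ℕ, (fun j => (Fin.cons p.1 e : Fin (i + 1) → ℕ) j + 1) =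
      Fin.cons (p.1 + 1) (fun j => e j + 1) := fun e => by
    funext j
    cases j using Fin.cases <;> simp
  simp only [hc, h2]
  split_ifs with h1
  · rw [Finset.mul_sum]
    refine Finset.sum_congr rfl fun e _ => ?_
    rw [Fin.cons_zero, show D + (i + 1) - (p.1 + 1) - (i + 1 - 1) = p.2 by omega,
      Nat.add_sub_cancel]
  · simp

/-- The summation index m+1 is the largest index m₁ of the multiple zeta value, and `QQ y s m`
supplies the smaller ones; removing the constant term in t of the first factor forces l₁ ≥ 2. -/
theorem co_genSum (w y s : ℂ) (i D : ℕ) :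
    co i D (genSum w y s) = s ^ i * weightedSum (D + (i + 1)) (i + 1) w y := by
  have h1 := (grow_term w y s).conv_serSum i D
  refine tendsto_nhds_unique h1 ?_
  rw [weightedSum_eq, Finset.mul_sum]
  simp only [map_sum, co_uu_sub_mul, co_QQ]
  simp only [Finset.sum_comm (t := antidiagonal D)]
  refine tendsto_finsetSum _ fun p _ => ?_
  split_ifs with hp
  · have h2 : ∀ e : Fin i → ℕ, Filter.Tendsto (fun N =>
        ((mzvTrunc (Fin.cons (p.1 + 1) (fun j => e j + 1) : Fin (i + 1) → ℕ) N : ℝ) : ℂ))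
        Filter.atTop (nhds
          (mzv (Fin.cons (p.1 + 1) (fun j => e j + 1) : Fin (i + 1) → ℕ) : ℂ)) := fun e =>
      (Complex.continuous_ofReal.tendsto _).comp (tendsto_mzvTrunc _ (by simpa using hp)
        fun j => by cases j using Fin.cases <;> simp)
    have h3 := (tendsto_finsetSum (Finset.Nat.antidiagonalTuple i p.2) fun e _ => h2 e).const_mul
      (s ^ i * (w ^ p.1 * y ^ p.2))
    rw [mul_assoc] at h3
    refine h3.congr fun N => ?_
    simp only [mzvTrunc_cons, Complex.ofReal_sum]
    rw [Finset.sum_comm, Finset.mul_sum]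
    refine Finset.sum_congr rfl fun j _ => ?_
    push_cast
    rw [← Finset.mul_sum]
    ring
  · simp

/-! ### Comparison of coefficients -/

/-- The formula in arbitrary depth i+1. The sign (−1)^i comes from s = −1 in the second generating
function and explains the alternation of sums and differences. -/
theorem weightedSum_sub (x y : ℂ) (i D : ℕ) (hD : D ≠ 0) :
    weightedSum (D + (i + 1)) (i + 1) (x + y) y -
        (-1) ^ i * weightedSum (D + (i + 1)) (i + 1) (y + x) x =
      (y ^ D - (-1) ^ i * x ^ D) * riemannZeta ((D + (i + 1) : ℕ) : ℂ) -
        PowerSeries.coeff D (PowerSeries.coeff (i + 1) (beta x y)) := by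
  have h := congrArg (co (i + 1) D) (zz_mul_genSum_sub x y 1)
  have h1 : co (i + 1) D 1 = 0 := by simp [co_apply, PowerSeries.coeff_one]
  rw [map_sub, map_sub, map_sub, h1, co_zz_mul, co_zz_mul, co_zz_mul, map_sub, co_genSum, co_genSum,
    coeff_genSum_self _ _ _ _ hD, coeff_genSum_self _ _ _ _ hD, ← beta, add_assoc D i 1,
    co_apply] at h
  rw [add_comm y x]
  linear_combination h

theorem PowerSeries.coeff_prod_fin {R : Type*} [CommRing R] {n : ℕ} (D : ℕ)
    (f : Fin n → PowerSeries R) : coeff D (∏ i, f i) =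
      ∑ e ∈ Finset.Nat.antidiagonalTuple n D, ∏ i, coeff (e i) (f i) := by
  induction n generalizing D with
  | zero => cases D <;> simp [coeff_one]
  | succ n ih =>
    rw [Fin.prod_univ_succ, coeff_mul, sum_antidiagonalTuple_succ]
    refine Finset.sum_congr rfl fun p _ => ?_
    rw [ih, Finset.mul_sum]
    exact Finset.sum_congr rfl fun e _ => by simp [Fin.prod_univ_succ]

/-- Translates the sums over tuples in the statement into coefficients of products of the `pw`. The
lower bounds correspond to exponents e_i ≥ 1 of t, and smaller exponents contribute nothing because
the constant terms vanish. -/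
theorem sum_tuples_eq_coeff {n : ℕ} (l D : ℕ) (b c : Fin n → ℕ) (hb : ∀ i, b i = c i + 1)
    (hl : l = D + ∑ i, c i) (f : Fin n → PowerSeries ℂ) (hf : ∀ i, PowerSeries.coeff 0 (f i) = 0)
    (F : (Fin n → ℕ) → ℂ) (r : ℂ)
    (hF : ∀ e : Fin n → ℕ, (∀ i, e i ≠ 0) →
      F (fun i => e i + c i) = r * ∏ i, PowerSeries.coeff (e i) (f i)) :
    ∑ j ∈ tuples l b, F j = r * PowerSeries.coeff D (∏ i, f i) := by
  rw [hl, sum_tuples D b c (fun i => (hb i).symm ▸ Nat.le_succ _), PowerSeries.coeff_prod_fin,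
    Finset.mul_sum]
  refine Finset.sum_congr rfl fun e _ => ?_
  split_ifs with h
  · exact hF e fun i => by have := h i; have := hb i; omega
  · push Not at h
    obtain ⟨i, hi⟩ := h
    have h0 : e i = 0 := by have := hb i; omega
    rw [Finset.prod_eq_zero (Finset.mem_univ i) (by rw [h0, hf]), mul_zero]

theorem coeff_zero_pw (x y : ℂ) (r : ℕ) : PowerSeries.coeff 0 (pw x y r) = 0 := by simp [pw]

theorem coeff_pw (x y : ℂ) (r : ℕ) {d : ℕ} (hd : d ≠ 0) : PowerSeries.coeff d (pw x y r) =
    ((d + r).choose r : ℂ) * ((-1) ^ r * y ^ d - x ^ d) * riemannZeta ((d + r + 1 : ℕ) : ℂ) := by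
  simp [pw, hd]

theorem cast_choose_two (d : ℕ) : ((d + 2).choose 2 : ℂ) = ((d : ℂ) + 2) * (d + 1) / 2 := by
  rw [Nat.cast_choose_two]
  push_cast
  ring

theorem cast_choose_three (d : ℕ) :
    ((d + 3).choose 3 : ℂ) = ((d : ℂ) + 3) * (d + 2) * (d + 1) / 6 := by
  induction d with
  | zero => norm_num
  | succ d ih =>
    rw [show d + 1 + 3 = d + 3 + 1 by ring, Nat.choose_succ_succ, Nat.cast_add, ih,
      show d + 3 = d + 1 + 2 by ring, cast_choose_two]
    push_cast
    ring

theorem coeff_pw_zero (x y : ℂ) {d : ℕ} (hd : d ≠ 0) : PowerSeries.coeff d (pw x y 0) =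
    (y ^ d - x ^ d) * riemannZeta ((d + 1 : ℕ) : ℂ) := by
  simp [coeff_pw x y 0 hd]

theorem coeff_pw_one (x y : ℂ) {d : ℕ} (hd : d ≠ 0) : PowerSeries.coeff d (pw x y 1) =
    -(((d : ℂ) + 1) * (x ^ d + y ^ d) * riemannZeta ((d + 2 : ℕ) : ℂ)) := by
  rw [coeff_pw x y 1 hd, Nat.choose_one_right]
  push_cast
  ring_nf

theorem coeff_pw_two (x y : ℂ) {d : ℕ} (hd : d ≠ 0) : PowerSeries.coeff d (pw x y 2) =
    ((d : ℂ) + 2) * (d + 1) / 2 * (y ^ d - x ^ d) * riemannZeta ((d + 3 : ℕ) : ℂ) := by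
  rw [coeff_pw x y 2 hd, cast_choose_two, neg_one_sq, one_mul]

theorem coeff_pw_three (x y : ℂ) {d : ℕ} (hd : d ≠ 0) : PowerSeries.coeff d (pw x y 3) =
    -(((d : ℂ) + 3) * (d + 2) * (d + 1) / 6 * (x ^ d + y ^ d) *
      riemannZeta ((d + 4 : ℕ) : ℂ)) := by
  rw [coeff_pw x y 3 hd, cast_choose_three]
  push_cast
  ring_nf

theorem coeff_one_beta (x y : ℂ) : PowerSeries.coeff 1 (beta x y) = pw x y 0 := by
  have h := succ_mul_coeff_beta x y 0
  simpa [coeff_zero_beta] using h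

theorem two_mul_coeff_two_beta (x y : ℂ) :
    2 * PowerSeries.coeff 2 (beta x y) = pw x y 0 * pw x y 0 + pw x y 1 := by
  have h := succ_mul_coeff_beta x y 1
  simp only [Finset.Nat.sum_antidiagonal_succ, Finset.Nat.antidiagonal_zero, Finset.sum_singleton,
    coeff_zero_beta, coeff_one_beta, zero_add, one_mul, Nat.cast_one, Nat.reduceAdd] at h
  linear_combination h

theorem six_mul_coeff_three_beta (x y : ℂ) :
    6 * PowerSeries.coeff 3 (beta x y) =
      pw x y 0 * pw x y 0 * pw x y 0 + 3 * (pw x y 0 * pw x y 1) + 2 * pw x y 2 := by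
  have h := succ_mul_coeff_beta x y 2
  have h2 := two_mul_coeff_two_beta x y
  simp only [Finset.Nat.sum_antidiagonal_succ, Finset.Nat.antidiagonal_zero, Finset.sum_singleton,
    coeff_zero_beta, coeff_one_beta, zero_add, one_mul, Nat.cast_ofNat, Nat.reduceAdd] at h
  linear_combination 2 * h + pw x y 0 * h2

theorem mul_coeff_four_beta (x y : ℂ) :
    24 * PowerSeries.coeff 4 (beta x y) =
      pw x y 0 * pw x y 0 * pw x y 0 * pw x y 0 + 6 * (pw x y 0 * pw x y 0 * pw x y 1) +
        3 * (pw x y 1 * pw x y 1) + 8 * (pw x y 0 * pw x y 2) + 6 * pw x y 3 := by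
  have h := succ_mul_coeff_beta x y 3
  have h2 := two_mul_coeff_two_beta x y
  have h3 := six_mul_coeff_three_beta x y
  simp only [Finset.Nat.sum_antidiagonal_succ, Finset.Nat.antidiagonal_zero, Finset.sum_singleton,
    coeff_zero_beta, coeff_one_beta, zero_add, one_mul, Nat.cast_ofNat, Nat.reduceAdd] at h
  linear_combination 6 * h + pw x y 0 * h3 + 3 * pw x y 1 * h2

theorem PowerSeries.coeff_ofNat_mul {R : Type*} [CommRing R] (n d : ℕ) [n.AtLeastTwo]
    (f : PowerSeries R) : coeff d (OfNat.ofNat n * f) = OfNat.ofNat n * coeff d f := by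
  have : (OfNat.ofNat n : PowerSeries R) = C (OfNat.ofNat n : R) := (map_ofNat C n).symm
  rw [this, coeff_C_mul]

theorem weightedSum_two (x y : ℂ) (l : ℕ) (hl : 3 ≤ l) :
    weightedSum l 2 (x + y) y + weightedSum l 2 (y + x) x =
      ((l : ℂ) + 1) / 2 * (x ^ (l - 2) + y ^ (l - 2)) * riemannZeta l
      - 1 / 2 * ∑ j ∈ tuples l ![2, 2],
          ∏ i, (x ^ (j i - 1) - y ^ (j i - 1)) * riemannZeta (j i) := by
  obtain ⟨D, rfl⟩ := Nat.exists_eq_add_of_le' (show 2 ≤ l by omega)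
  have hD : D ≠ 0 := by omega
  have h : weightedSum (D + 2) 2 (x + y) y - (-1) ^ 1 * weightedSum (D + 2) 2 (y + x) x =
      (y ^ D - (-1) ^ 1 * x ^ D) * riemannZeta ((D + 2 : ℕ) : ℂ) -
        PowerSeries.coeff D (PowerSeries.coeff 2 (beta x y)) := weightedSum_sub x y 1 D hD
  have hb := congrArg (PowerSeries.coeff D) (two_mul_coeff_two_beta x y)
  rw [map_add, PowerSeries.coeff_ofNat_mul, coeff_pw_one _ _ hD] at hb
  have h22 := sum_tuples_eq_coeff (D + 2) D ![2, 2] ![1, 1] (by decide) (by simp)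
    ![pw x y 0, pw x y 0] (fun i => by fin_cases i <;> exact coeff_zero_pw _ _ _)
    (fun j => ∏ i, (x ^ (j i - 1) - y ^ (j i - 1)) * riemannZeta (j i)) 1 (fun e he => by
      simp [Fin.prod_univ_two, coeff_pw_zero _ _ (he _)]
      ring)
  rw [h22, Nat.add_sub_cancel, Fin.prod_univ_two]
  simp only [Matrix.cons_val_zero, Matrix.cons_val_one]
  have hc : ((D + 2 : ℕ) : ℂ) = D + 2 := by push_cast; ring
  rw [hc] at h hb ⊢
  -- The factor (l+1)/2 of ζ(l) is 1 from the sum formula plus (l−1)/2 from `pw x y 1`.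
  linear_combination h - hb / 2

theorem weightedSum_three (x y : ℂ) (l : ℕ) (hl : 4 ≤ l) :
    weightedSum l 3 (x + y) y - weightedSum l 3 (y + x) x =
      ((l : ℂ) + 1) * ((l : ℂ) - 4) / 6 * (x ^ (l - 3) - y ^ (l - 3)) * riemannZeta l
      - 1 / 2 * ∑ j ∈ tuples l ![2, 3], ((j 1 : ℂ) - 1) *
          ∏ i, (x ^ (j i - 1 - kron i 1) - (-1) ^ kron i 1 * y ^ (j i - 1 - kron i 1)) *
            riemannZeta (j i)
      + 1 / 6 * ∑ j ∈ tuples l ![2, 2, 2],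
          ∏ i, (x ^ (j i - 1) - y ^ (j i - 1)) * riemannZeta (j i) := by
  obtain ⟨D, rfl⟩ := Nat.exists_eq_add_of_le' (show 3 ≤ l by omega)
  have hD : D ≠ 0 := by omega
  have h : weightedSum (D + 3) 3 (x + y) y - (-1) ^ 2 * weightedSum (D + 3) 3 (y + x) x =
      (y ^ D - (-1) ^ 2 * x ^ D) * riemannZeta ((D + 3 : ℕ) : ℂ) -
        PowerSeries.coeff D (PowerSeries.coeff 3 (beta x y)) := weightedSum_sub x y 2 D hD
  have hb := congrArg (PowerSeries.coeff D) (six_mul_coeff_three_beta x y)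
  simp only [map_add] at hb
  rw [PowerSeries.coeff_ofNat_mul, PowerSeries.coeff_ofNat_mul, PowerSeries.coeff_ofNat_mul,
    coeff_pw_two _ _ hD] at hb
  have h23 := sum_tuples_eq_coeff (D + 3) D ![2, 3] ![1, 2] (by decide) (by simp)
    ![pw x y 0, pw x y 1] (fun i => by fin_cases i <;> exact coeff_zero_pw _ _ _)
    (fun j => ((j 1 : ℂ) - 1) *
          ∏ i, (x ^ (j i - 1 - kron i 1) - (-1) ^ kron i 1 * y ^ (j i - 1 - kron i 1)) *
            riemannZeta (j i)) 1 (fun e he => by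
      simp [Fin.prod_univ_two, coeff_pw_zero _ _ (he _), coeff_pw_one _ _ (he _), kron]
      ring)
  -- The sign −1 reverses y^d − x^d in each of the three factors `pw x y 0`.
  have h222 := sum_tuples_eq_coeff (D + 3) D ![2, 2, 2] ![1, 1, 1] (by decide)
    (by simp [Fin.sum_univ_three])
    ![pw x y 0, pw x y 0, pw x y 0] (fun i => by fin_cases i <;> exact coeff_zero_pw _ _ _)
    (fun j => ∏ i, (x ^ (j i - 1) - y ^ (j i - 1)) * riemannZeta (j i)) (-1) (fun e he => by
      simp [Fin.prod_univ_three, coeff_pw_zero _ _ (he _)]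
      ring)
  rw [h23, h222, Nat.add_sub_cancel, Fin.prod_univ_two, Fin.prod_univ_three]
  simp only [Matrix.cons_val_zero, Matrix.cons_val_one, Matrix.cons_val]
  have hc : ((D + 3 : ℕ) : ℂ) = D + 3 := by push_cast; ring
  rw [hc] at h hb ⊢
  linear_combination h - hb / 6

theorem weightedSum_four (x y : ℂ) (l : ℕ) (hl : 5 ≤ l) :
    weightedSum l 4 (x + y) y + weightedSum l 4 (y + x) x =
      ((l : ℂ) + 1) * ((l : ℂ) ^ 2 - 7 * (l : ℂ) + 18) / 24 *
        (x ^ (l - 4) + y ^ (l - 4)) * riemannZeta l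
      - 1 / 6 * ∑ j ∈ tuples l ![2, 4], ((j 1 : ℂ) - 1) * ((j 1 : ℂ) - 2) *
          ∏ i, (x ^ (j i - 1 - 2 * kron i 1) - y ^ (j i - 1 - 2 * kron i 1)) *
            riemannZeta (j i)
      - 1 / 8 * ∑ j ∈ tuples l ![3, 3],
          ∏ i, ((j i : ℂ) - 1) * (x ^ (j i - 2) + y ^ (j i - 2)) * riemannZeta (j i)
      + 1 / 4 * ∑ j ∈ tuples l ![2, 2, 3], ((j 2 : ℂ) - 1) *
          ∏ i, (x ^ (j i - 1 - kron i 2) - (-1) ^ kron i 2 * y ^ (j i - 1 - kron i 2)) *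
            riemannZeta (j i)
      - 1 / 24 * ∑ j ∈ tuples l ![2, 2, 2, 2],
          ∏ i, (x ^ (j i - 1) - y ^ (j i - 1)) * riemannZeta (j i) := by
  obtain ⟨D, rfl⟩ := Nat.exists_eq_add_of_le' (show 4 ≤ l by omega)
  have hD : D ≠ 0 := by omega
  have h : weightedSum (D + 4) 4 (x + y) y - (-1) ^ 3 * weightedSum (D + 4) 4 (y + x) x =
      (y ^ D - (-1) ^ 3 * x ^ D) * riemannZeta ((D + 4 : ℕ) : ℂ) -
        PowerSeries.coeff D (PowerSeries.coeff 4 (beta x y)) := weightedSum_sub x y 3 D hD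
  have hb := congrArg (PowerSeries.coeff D) (mul_coeff_four_beta x y)
  simp only [map_add] at hb
  rw [PowerSeries.coeff_ofNat_mul, PowerSeries.coeff_ofNat_mul, PowerSeries.coeff_ofNat_mul,
    PowerSeries.coeff_ofNat_mul, PowerSeries.coeff_ofNat_mul, coeff_pw_three _ _ hD] at hb
  -- The factor 2 compensates for the binomial coefficient (j₂−1)(j₂−2)/2 in `pw x y 2`.
  have h24 := sum_tuples_eq_coeff (D + 4) D ![2, 4] ![1, 3] (by decide) (by simp)
    ![pw x y 0, pw x y 2] (fun i => by fin_cases i <;> exact coeff_zero_pw _ _ _)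
    (fun j => ((j 1 : ℂ) - 1) * ((j 1 : ℂ) - 2) *
          ∏ i, (x ^ (j i - 1 - 2 * kron i 1) - y ^ (j i - 1 - 2 * kron i 1)) *
            riemannZeta (j i)) 2 (fun e he => by
      simp [Fin.prod_univ_two, coeff_pw_zero _ _ (he _), coeff_pw_two _ _ (he _), kron]
      ring)
  have h33 := sum_tuples_eq_coeff (D + 4) D ![3, 3] ![2, 2] (by decide) (by simp)
    ![pw x y 1, pw x y 1] (fun i => by fin_cases i <;> exact coeff_zero_pw _ _ _)
    (fun j => ∏ i, ((j i : ℂ) - 1) * (x ^ (j i - 2) + y ^ (j i - 2)) * riemannZeta (j i)) 1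
    (fun e he => by
      simp [Fin.prod_univ_two, coeff_pw_one _ _ (he _)]
      ring)
  have h223 := sum_tuples_eq_coeff (D + 4) D ![2, 2, 3] ![1, 1, 2] (by decide)
    (by simp [Fin.sum_univ_three])
    ![pw x y 0, pw x y 0, pw x y 1] (fun i => by fin_cases i <;> exact coeff_zero_pw _ _ _)
    (fun j => ((j 2 : ℂ) - 1) *
          ∏ i, (x ^ (j i - 1 - kron i 2) - (-1) ^ kron i 2 * y ^ (j i - 1 - kron i 2)) *
            riemannZeta (j i)) (-1) (fun e he => by
      simp [Fin.prod_univ_three, coeff_pw_zero _ _ (he _), coeff_pw_one _ _ (he _), kron]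
      ring)
  have h2222 := sum_tuples_eq_coeff (D + 4) D ![2, 2, 2, 2] ![1, 1, 1, 1] (by decide)
    (by simp [Fin.sum_univ_four])
    ![pw x y 0, pw x y 0, pw x y 0, pw x y 0]
    (fun i => by fin_cases i <;> exact coeff_zero_pw _ _ _)
    (fun j => ∏ i, (x ^ (j i - 1) - y ^ (j i - 1)) * riemannZeta (j i)) 1 (fun e he => by
      simp [Fin.prod_univ_four, coeff_pw_zero _ _ (he _)]
      ring)
  rw [h24, h33, h223, h2222, Nat.add_sub_cancel]
  simp only [Fin.prod_univ_two, Fin.prod_univ_three, Fin.prod_univ_four, Matrix.cons_val_zero,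
    Matrix.cons_val_one, Matrix.cons_val]
  have hc : ((D + 4 : ℕ) : ℂ) = D + 4 := by push_cast; ring
  rw [hc] at h hb ⊢
  linear_combination h - hb / 24

/-- For x = y = 1 every product of differences vanishes, the two weighted sums coincide, and the
weight is 2^{j−1} = 2^j/2. -/
theorem sum_two_pow_mul_mzv (l : ℕ) (hl : 3 ≤ l) :
    ∑ j ∈ Finset.Icc 2 (l - 1), 2 ^ j * (mzv ![j, l - j] : ℂ) = ((l : ℂ) + 1) * riemannZeta l := by
  have h := weightedSum_two 1 1 l hl
  have e : weightedSum l 2 (1 + 1) 1 =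
      1 / 2 * ∑ j ∈ Finset.Icc 2 (l - 1), 2 ^ j * (mzv ![j, l - j] : ℂ) := by
    rw [weightedSum, Finset.mul_sum]
    refine Finset.sum_bij' (fun k _ => k 0) (fun j _ => ![j, l - j]) ?_ ?_ ?_ ?_ ?_
    · intro k hk
      obtain ⟨h1, h2⟩ := mem_tuples.mp hk
      rw [Fin.sum_univ_two] at h1
      have h3 := h2 0
      have h4 := h2 1
      simp only [if_true, one_ne_zero, if_false] at h3 h4
      rw [Finset.mem_Icc]
      omega
    · intro j hj
      rw [Finset.mem_Icc] at hj
      refine mem_tuples.mpr ⟨by simp [Fin.sum_univ_two]; omega, ?_⟩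
      rw [Fin.forall_fin_two]
      simp
      omega
    · intro k hk
      obtain ⟨h1, -⟩ := mem_tuples.mp hk
      rw [Fin.sum_univ_two] at h1
      funext i
      fin_cases i
      · rfl
      · simp; omega
    · intro j _
      rfl
    · intro k hk
      obtain ⟨h1, h2⟩ := mem_tuples.mp hk
      rw [Fin.sum_univ_two] at h1
      have h3 : k = ![k 0, l - k 0] := by
        funext i
        fin_cases i
        · rfl
        · simp; omega
      have h4 := h2 0
      simp only [if_true] at h4
      obtain ⟨a, ha⟩ := Nat.exists_eq_add_of_le' (show 1 ≤ k 0 by omega)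
      rw [← h3, ha, Nat.add_sub_cancel, one_pow, pow_succ]
      norm_num
      ring
  rw [e] at h
  simp only [sub_self, one_pow, zero_mul] at h
  have h0 : ∑ j ∈ tuples l ![2, 2], ∏ i : Fin 2, (0 : ℂ) = 0 :=
    Finset.sum_eq_zero fun j _ => by simp
  rw [h0] at h
  linear_combination h

theorem mainTheorem4 :
    (∀ x y : ℂ,
      -- depth two
      (∀ l : ℕ, 3 ≤ l →
        weightedSum l 2 (x + y) y + weightedSum l 2 (y + x) x =
          ((l : ℂ) + 1) / 2 * (x ^ (l - 2) + y ^ (l - 2)) * riemannZeta l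
          - 1 / 2 * ∑ j ∈ tuples l ![2, 2],
              ∏ i, (x ^ (j i - 1) - y ^ (j i - 1)) * riemannZeta (j i)) ∧
      -- depth three
      (∀ l : ℕ, 4 ≤ l →
        weightedSum l 3 (x + y) y - weightedSum l 3 (y + x) x =
          ((l : ℂ) + 1) * ((l : ℂ) - 4) / 6 * (x ^ (l - 3) - y ^ (l - 3)) * riemannZeta l
          - 1 / 2 * ∑ j ∈ tuples l ![2, 3], ((j 1 : ℂ) - 1) *
              ∏ i, (x ^ (j i - 1 - kron i 1) - (-1) ^ kron i 1 * y ^ (j i - 1 - kron i 1)) *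
                riemannZeta (j i)
          + 1 / 6 * ∑ j ∈ tuples l ![2, 2, 2],
              ∏ i, (x ^ (j i - 1) - y ^ (j i - 1)) * riemannZeta (j i)) ∧
      -- depth four
      (∀ l : ℕ, 5 ≤ l →
        weightedSum l 4 (x + y) y + weightedSum l 4 (y + x) x =
          ((l : ℂ) + 1) * ((l : ℂ) ^ 2 - 7 * (l : ℂ) + 18) / 24 *
            (x ^ (l - 4) + y ^ (l - 4)) * riemannZeta l
          - 1 / 6 * ∑ j ∈ tuples l ![2, 4], ((j 1 : ℂ) - 1) * ((j 1 : ℂ) - 2) *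
              ∏ i, (x ^ (j i - 1 - 2 * kron i 1) - y ^ (j i - 1 - 2 * kron i 1)) *
                riemannZeta (j i)
          - 1 / 8 * ∑ j ∈ tuples l ![3, 3],
              ∏ i, ((j i : ℂ) - 1) * (x ^ (j i - 2) + y ^ (j i - 2)) * riemannZeta (j i)
          + 1 / 4 * ∑ j ∈ tuples l ![2, 2, 3], ((j 2 : ℂ) - 1) *
              ∏ i, (x ^ (j i - 1 - kron i 2) - (-1) ^ kron i 2 * y ^ (j i - 1 - kron i 2)) *
                riemannZeta (j i)
          - 1 / 24 * ∑ j ∈ tuples l ![2, 2, 2, 2],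
              ∏ i, (x ^ (j i - 1) - y ^ (j i - 1)) * riemannZeta (j i))) ∧
    -- the case `x = y = 1` of depth two
    (∀ l : ℕ, 3 ≤ l →
      ∑ j ∈ Finset.Icc 2 (l - 1), 2 ^ j * (mzv ![j, l - j] : ℂ) =
        ((l : ℂ) + 1) * riemannZeta l) := by
  exact ⟨fun x y => ⟨weightedSum_two x y, weightedSum_three x y, weightedSum_four x y⟩,
    sum_two_pow_mul_mzv⟩
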